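/- Let $A$ and $B$ be lattices, and write $0_L$ for the zero (least element) of a lattice $L$ when it exists. For $(a,b)\in A\times B$ put \[ a\mathbin{\square} b=\{(x,y)\in A\times B : x\le a\text{ or }y\le b\}. \] The box product $A\mathbin{\square} B$ is the set of all finite intersections $\bigcap_{i<n}(a_i\mathbin{\square} b_i)$ with $n>0$, a lattice with respect to containment, whose meet is intersection. Put $\bot_L=\{0_L\}$ if the lattice $L$ has a zero and $\bot_L=\varnothing$ otherwise, $\bot_{A,B}=(A\times\bot_B)\cup(\bot_A\times B)$, and \[ a\boxtimes b=\{(x,y)\in A\times B : x\le a\text{ and }y\le b\}\cup\bot_{A,B}. \] The lattice tensor product $A\boxtimes B$ is the set of all $H\in A\mathbin{\square} B$ that are contained in $a\boxtimes b$ for some $(a,b)\in A\times B$; it is closed under the meets and joins of $A\mathbin{\square} B$. For a lattice $L$, let $\operatorname{Con_c}L$ be the $\{\vee,0\}$-semilattice of compact congruences of $L$ and let $\Theta_L(u,v)$ be the least congruence of $L$ identifying $u$ and $v$. For $\{\vee,0\}$-semilattices $S$ and $T$, let $S\otimes T$ be the $\{\vee,0\}$-semilattice generated by the pairs $(s,t)$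 with $s\in S\setminus\{0\}$, $t\in T\setminus\{0\}$, subject to the relations $(s,t_0)\vee(s,t_1)=(s,t_0\vee t_1)$ and $(s_0,t)\vee(s_1,t)=(s_0\vee s_1,t)$; the pure tensor $s\otimes t$ is the image of $(s,t)$ if $s\ne0$ and $t\neq 0$, and is $0$ otherwise. Theorem. If $A\boxtimes B$ is nonempty, then there is an isomorphism of $\{\vee,0\}$-semilattices \[ \mu\colon \operatorname{Con_c}A\otimes\operatorname{Con_c}B\longrightarrow\operatorname{Con_c}(A\boxtimes B) \] such that, for all $a_0\le a_1$ in $A$ and $b_0\le b_1$ in $B$, with $\alpha=\Theta_A(a_0,a_1)$ and $\beta=\Theta_B(b_0,b_1)$: (i) if $A$ and $B$ both have a zero, then \[ \mu(\alpha\otimes\beta)=\Theta_{A\boxtimes B}\bigl((a_0\boxtimes b_1)\vee(a_1\boxtimes b_0),\ a_1\boxtimes b_1\bigr); \] (ii) if $A$ is bounded, then \[ \mu(\alpha\otimes\beta)=\Theta_{A\boxtimes B}\bigl((a_0\mathbin{\square} b_0)\cap(0_A\mathbin{\square} b_1),\ (a_1\mathbin{\square} b_0)\cap(0_A\mathbin{\square}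 b_1)\bigr), \] and symmetrically, if $B$ is bounded, then \[ \mu(\alpha\otimes\beta)=\Theta_{A\boxtimes B}\bigl((a_0\mathbin{\square} b_0)\cap(a_1\mathbin{\square} 0_B),\ (a_0\mathbin{\square} b_1)\cap(a_1\mathbin{\square} 0_B)\bigr); \] (iii) if $A$ and $B$ both have a unit, then \[ \mu(\alpha\otimes\beta)=\Theta_{A\boxtimes B}\bigl(a_0\mathbin{\square} b_0,\ (a_0\mathbin{\square} b_1)\cap(a_1\mathbin{\square} b_0)\bigr). \] -/

import Mathlib

/-! ### Congruence lattices -/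

namespace LatticeCon

variable {L : Type*} [Lattice L]

/-- Congruences are ordered by containment. -/
instance : PartialOrder (LatticeCon L) where
  le θ ψ := ∀ ⦃x y : L⦄, θ.r x y → ψ.r x y
  le_refl _ _ _ h := h
  le_trans _ _ _ h₁ h₂ _ _ h := h₂ (h₁ h)
  le_antisymm θ ψ h₁ h₂ := by
    cases θ with
    | mk s _ _ =>
      cases ψ with
      | mk t _ _ =>
        have hst : s = t := Setoid.ext fun a b => ⟨fun h => h₁ h, fun h => h₂ h⟩
        subst hst
        rfl

/-- The intersection of a set of congruences. -/
instance : InfSet (LatticeCon L) where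
  sInf S :=
    { r := fun x y => ∀ θ ∈ S, θ.r x y
      iseqv :=
        { refl := fun x θ _ => θ.refl x
          symm := fun h θ hθ => θ.symm (h θ hθ)
          trans := fun h₁ h₂ θ hθ => θ.trans (h₁ θ hθ) (h₂ θ hθ) }
      inf := fun h₁ h₂ θ hθ => θ.inf (h₁ θ hθ) (h₂ θ hθ)
      sup := fun h₁ h₂ θ hθ => θ.sup (h₁ θ hθ) (h₂ θ hθ) }

/-- The congruence lattice `Con L`. -/
instance : CompleteLattice (LatticeCon L) :=
  completeLatticeOfInf (LatticeCon L) fun _ =>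
    ⟨fun _ hθ _ _ h => h _ hθ, fun _ hψ _ _ h _ hθ => hψ hθ h⟩

/-- The principal congruence `Θ(x, y)`: the least congruence identifying `x` and `y`. -/
def principal (x y : L) : LatticeCon L := sInf {θ | θ.r x y}

theorem principal_le_iff {x y : L} {θ : LatticeCon L} : principal x y ≤ θ ↔ θ.r x y :=
  ⟨fun h => h fun _ hψ => hψ, fun h _ _ hab => hab θ h⟩

/-- The union of a nonempty directed set of congruences. -/
def directedUnion (S : Set (LatticeCon L)) (hne : S.Nonempty) (hS : DirectedOn (· ≤ ·) S) :
    LatticeCon L where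
  r x y := ∃ θ ∈ S, θ.r x y
  iseqv :=
    { refl := fun x => hne.imp fun θ hθ => ⟨hθ, θ.refl x⟩
      symm := fun ⟨θ, hθ, h⟩ => ⟨θ, hθ, θ.symm h⟩
      trans := fun ⟨θ, hθ, h⟩ ⟨ψ, hψ, h'⟩ =>
        let ⟨χ, hχ, h₁, h₂⟩ := hS θ hθ ψ hψ
        ⟨χ, hχ, χ.trans (h₁ h) (h₂ h')⟩ }
  inf := fun ⟨θ, hθ, h⟩ ⟨ψ, hψ, h'⟩ =>
    let ⟨χ, hχ, h₁, h₂⟩ := hS θ hθ ψ hψ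
    ⟨χ, hχ, χ.inf (h₁ h) (h₂ h')⟩
  sup := fun ⟨θ, hθ, h⟩ ⟨ψ, hψ, h'⟩ =>
    let ⟨χ, hχ, h₁, h₂⟩ := hS θ hθ ψ hψ
    ⟨χ, hχ, χ.sup (h₁ h) (h₂ h')⟩

theorem isCompactElement_principal (x y : L) : IsCompactElement (principal x y) := by
  intro S u hne hdir hu hle
  have hub : u ≤ directedUnion S hne hdir := hu.2 fun θ hθ _ _ h => ⟨θ, hθ, h⟩
  obtain ⟨θ, hθ, h⟩ := principal_le_iff.1 (hle.trans hub)
  exact ⟨θ, hθ, principal_le_iff.2 h⟩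

end LatticeCon

/-- `Conc L`: the compact congruences of `L`. -/
def Conc (L : Type*) [Lattice L] := {θ : LatticeCon L // IsCompactElement θ}

namespace Conc

variable {L : Type*} [Lattice L]

/-- `Conc L` as a join-subsemilattice of the congruence lattice. -/
instance : SemilatticeSup (Conc L) :=
  Subtype.semilatticeSup (P := fun θ : LatticeCon L => IsCompactElement θ) fun θ ψ hθ hψ => by
    intro S u hne hdir hu hle
    obtain ⟨a, ha, h₁⟩ := hθ S u hne hdir hu (le_sup_left.trans hle)
    obtain ⟨b, hb, h₂⟩ := hψ S u hne hdir hu (le_sup_right.trans hle)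
    obtain ⟨c, hc, hac, hbc⟩ := hdir a ha b hb
    exact ⟨c, hc, sup_le (h₁.trans hac) (h₂.trans hbc)⟩

/-- The zero of `Conc L` is the identity congruence, the least congruence of `L`. -/
instance : OrderBot (Conc L) where
  bot := ⟨⊥, fun _ _ hne _ _ _ => hne.imp fun _ hx => ⟨hx, bot_le⟩⟩
  bot_le θ := show (⊥ : LatticeCon L) ≤ θ.1 from bot_le

/-- The principal congruence `Θ(x, y)` as an element of `Conc L`. -/
def principal (x y : L) : Conc L :=
  ⟨LatticeCon.principal x y, LatticeCon.isCompactElement_principal x y⟩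

end Conc

/-! ### The tensor product of join-semilattices with zero -/

/-- Terms in the operations `⊔` and `0` over the generators `⟨a, b⟩`, `a ≠ 0`, `b ≠ 0`. -/
inductive TensorTerm (S T : Type*) [SemilatticeSup S] [OrderBot S] [SemilatticeSup T] [OrderBot T]
  | zero : TensorTerm S T
  | gen (a : {a : S // a ≠ ⊥}) (b : {b : T // b ≠ ⊥}) : TensorTerm S T
  | sup (x y : TensorTerm S T) : TensorTerm S T

/-- The congruence on terms generated by the laws of join-semilattices with zero and by the
bilinearity relations of the tensor product. -/
inductive TensorRel {S T : Type*} [SemilatticeSup S] [OrderBot S] [SemilatticeSup T]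
    [OrderBot T] : TensorTerm S T → TensorTerm S T → Prop
  | refl (x : TensorTerm S T) : TensorRel x x
  | symm {x y : TensorTerm S T} : TensorRel x y → TensorRel y x
  | trans {x y z : TensorTerm S T} : TensorRel x y → TensorRel y z → TensorRel x z
  | congr {x x' y y' : TensorTerm S T} : TensorRel x x' → TensorRel y y' → TensorRel (x.sup y) (x'.sup y')
  | comm (x y : TensorTerm S T) : TensorRel (x.sup y) (y.sup x)
  | assoc (x y z : TensorTerm S T) : TensorRel ((x.sup y).sup z) (x.sup (y.sup z))
  | idem (x : TensorTerm S T) : TensorRel (x.sup x) x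
  | zero_sup (x : TensorTerm S T) : TensorRel (TensorTerm.zero.sup x) x
  | gen_right (a : {a : S // a ≠ ⊥}) (b₀ b₁ b : {b : T // b ≠ ⊥})
      (hb : (b₀ : T) ⊔ (b₁ : T) = b) :
      TensorRel ((TensorTerm.gen a b₀).sup (.gen a b₁)) (.gen a b)
  | gen_left (a₀ a₁ a : {a : S // a ≠ ⊥}) (b : {b : T // b ≠ ⊥})
      (ha : (a₀ : S) ⊔ (a₁ : S) = a) :
      TensorRel ((TensorTerm.gen a₀ b).sup (.gen a₁ b)) (.gen a b)

/-- The equality of terms in the tensor product. -/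
def tensorSetoid (S T : Type*) [SemilatticeSup S] [OrderBot S] [SemilatticeSup T] [OrderBot T] :
    Setoid (TensorTerm S T) :=
  ⟨TensorRel, ⟨TensorRel.refl, TensorRel.symm, TensorRel.trans⟩⟩

/-- The tensor product `S ⊗ T` of two join-semilattices with zero. -/
def SemilatticeTensor (S T : Type*) [SemilatticeSup S] [OrderBot S] [SemilatticeSup T]
    [OrderBot T] := Quotient (tensorSetoid S T)

namespace SemilatticeTensor

variable {S T : Type*} [SemilatticeSup S] [OrderBot S] [SemilatticeSup T] [OrderBot T]

/-- The element of `S ⊗ T` given by a term. -/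
def mk (x : TensorTerm S T) : SemilatticeTensor S T := Quotient.mk _ x

instance : Max (SemilatticeTensor S T) :=
  ⟨Quotient.map₂ TensorTerm.sup fun _ _ h₁ _ _ h₂ => TensorRel.congr h₁ h₂⟩

/-- The order of `S ⊗ T` is the one induced by its join: `x ≤ y` iff `x ⊔ y = y`. -/
instance : SemilatticeSup (SemilatticeTensor S T) :=
  SemilatticeSup.mk'
    (by rintro ⟨x⟩ ⟨y⟩; exact Quotient.sound (TensorRel.comm x y))
    (by rintro ⟨x⟩ ⟨y⟩ ⟨z⟩; exact Quotient.sound (TensorRel.assoc x y z))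
    (by rintro ⟨x⟩; exact Quotient.sound (TensorRel.idem x))

instance : OrderBot (SemilatticeTensor S T) where
  bot := mk TensorTerm.zero
  bot_le := by rintro ⟨x⟩; exact Quotient.sound (TensorRel.zero_sup x)

open scoped Classical in
/-- The pure tensor `a ⊗ b`; it is zero if `a = 0` or `b = 0`. -/
noncomputable def pure (a : S) (b : T) : SemilatticeTensor S T :=
  if h : a ≠ ⊥ ∧ b ≠ ⊥ then mk (TensorTerm.gen ⟨a, h.1⟩ ⟨b, h.2⟩) else ⊥

end SemilatticeTensor

/-! ### The box product -/

section Box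

variable {A B : Type*} [Lattice A] [Lattice B]

/-- The set `a □ b`. -/
def boxSet (a : A) (b : B) : Set (A × B) := {p | p.1 ≤ a ∨ p.2 ≤ b}

theorem boxSet_mono {a a' : A} {b b' : B} (ha : a ≤ a') (hb : b ≤ b') :
    boxSet a b ⊆ boxSet a' b' := fun _ h => h.imp (·.trans ha) (·.trans hb)

/-- `H` is a finite intersection `⋂ i < n, aᵢ □ bᵢ` with `n > 0`. -/
def IsBoxInter (H : Set (A × B)) : Prop :=
  ∃ s : Finset (A × B), s.Nonempty ∧ H = ⋂ p ∈ s, boxSet p.1 p.2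

theorem isBoxInter_boxSet (a : A) (b : B) : IsBoxInter (boxSet a b) :=
  ⟨{(a, b)}, Finset.singleton_nonempty _, by simp⟩

theorem IsBoxInter.inter {H K : Set (A × B)} (hH : IsBoxInter H) (hK : IsBoxInter K) :
    IsBoxInter (H ∩ K) := by
  classical
  obtain ⟨s, hs, rfl⟩ := hH
  obtain ⟨t, ht, rfl⟩ := hK
  exact ⟨s ∪ t, hs.mono Finset.subset_union_left, by ext; simp only [Set.mem_inter_iff, Set.mem_iInter, Finset.mem_union, or_imp, forall_and]⟩

/-- Every finite intersection of boxes is a finite union of one box and of sets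
`{(x, y) | x ≤ c, y ≤ d}`. -/
theorem IsBoxInter.exists_union {H : Set (A × B)} (hH : IsBoxInter H) :
    ∃ (a : A) (b : B) (t : Finset (A × B)), H = boxSet a b ∪ {p | ∃ c ∈ t, p ≤ c} := by
  classical
  obtain ⟨s, hs, rfl⟩ := hH
  induction hs using Finset.Nonempty.cons_induction with
  | singleton p => exact ⟨p.1, p.2, ∅, by simp⟩
  | cons q s hq hs ih =>
    obtain ⟨a, b, t, h⟩ := ih
    refine ⟨q.1 ⊓ a, q.2 ⊓ b,
      {(q.1, b), (a, q.2)} ∪ (t.image fun c => (q.1 ⊓ c.1, c.2)) ∪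
        (t.image fun c => (c.1, q.2 ⊓ c.2)), ?_⟩
    have h' : ⋂ p ∈ Finset.cons q s hq, boxSet p.1 p.2 =
        boxSet q.1 q.2 ∩ (boxSet a b ∪ {p | ∃ c ∈ t, p ≤ c}) := by
      rw [← h]
      simp
    rw [h']
    ext ⟨x, y⟩
    simp only [boxSet, Set.mem_inter_iff, Set.mem_union, Set.mem_ofPred_eq, le_inf_iff]
    constructor
    · rintro ⟨h₁, h₂ | ⟨c, hc, hcx, hcy⟩⟩
      · rcases h₁ with h₁ | h₁ <;> rcases h₂ with h₂ | h₂
        · exact Or.inl (Or.inl ⟨h₁, h₂⟩)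
        · exact Or.inr ⟨(q.1, b), by simp, h₁, h₂⟩
        · exact Or.inr ⟨(a, q.2), by simp, h₂, h₁⟩
        · exact Or.inl (Or.inr ⟨h₁, h₂⟩)
      · rcases h₁ with h₁ | h₁
        · refine Or.inr ⟨(q.1 ⊓ c.1, c.2), ?_, le_inf h₁ hcx, hcy⟩
          exact Finset.mem_union_left _ (Finset.mem_union_right _ (Finset.mem_image_of_mem _ hc))
        · refine Or.inr ⟨(c.1, q.2 ⊓ c.2), ?_, hcx, le_inf h₁ hcy⟩
          exact Finset.mem_union_right _ (Finset.mem_image_of_mem _ hc)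
    · rintro ((⟨h₁, h₂⟩ | ⟨h₁, h₂⟩) | ⟨c, hc, hcx, hcy⟩)
      · exact ⟨Or.inl h₁, Or.inl (Or.inl h₂)⟩
      · exact ⟨Or.inr h₁, Or.inl (Or.inr h₂)⟩
      · simp only [Finset.mem_union, Finset.mem_insert, Finset.mem_singleton,
          Finset.mem_image] at hc
        rcases hc with ((rfl | rfl) | ⟨d, hd, rfl⟩) | ⟨d, hd, rfl⟩
        · exact ⟨Or.inl hcx, Or.inl (Or.inr hcy)⟩
        · exact ⟨Or.inr hcy, Or.inl (Or.inl hcx)⟩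
        · exact ⟨Or.inl (le_trans hcx inf_le_left),
            Or.inr ⟨d, hd, le_trans hcx inf_le_right, hcy⟩⟩
        · exact ⟨Or.inr (le_trans hcy inf_le_left),
            Or.inr ⟨d, hd, hcx, le_trans hcy inf_le_right⟩⟩

/-- The least finite intersection of boxes containing `H ∪ K`. -/
def boxClosure (H K : Set (A × B)) : Set (A × B) := ⋂₀ {M | IsBoxInter M ∧ H ⊆ M ∧ K ⊆ M}

theorem isBoxInter_boxClosure {H K : Set (A × B)} (hH : IsBoxInter H) (hK : IsBoxInter K) :
    IsBoxInter (boxClosure H K) := by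
  classical
  obtain ⟨a, b, t, rfl⟩ := hH.exists_union
  obtain ⟨a', b', t', rfl⟩ := hK.exists_union
  let u := t ∪ t'
  let f : Finset (A × B) → A × B := fun X =>
    (X.fold (fun x y : A => x ⊔ y) (a ⊔ a') Prod.fst, (u \ X).fold (fun x y : B => x ⊔ y) (b ⊔ b') Prod.snd)
  have fst_le : ∀ (X : Finset (A × B)) (e : A),
      X.fold (fun x y : A => x ⊔ y) (a ⊔ a') Prod.fst ≤ e ↔ a ⊔ a' ≤ e ∧ ∀ c ∈ X, c.1 ≤ e := fun X e => by
    induction X using Finset.induction_on with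
    | empty => simp
    | insert c X hc ih => rw [Finset.fold_insert hc, sup_le_iff, ih]; simp; tauto
  have snd_le : ∀ (X : Finset (A × B)) (e : B),
      X.fold (fun x y : B => x ⊔ y) (b ⊔ b') Prod.snd ≤ e ↔ b ⊔ b' ≤ e ∧ ∀ c ∈ X, c.2 ≤ e := fun X e => by
    induction X using Finset.induction_on with
    | empty => simp
    | insert c X hc ih => rw [Finset.fold_insert hc, sup_le_iff, ih]; simp; tauto
  have hf₁ : ∀ X, a ⊔ a' ≤ (f X).1 ∧ ∀ c ∈ X, c.1 ≤ (f X).1 := fun X => (fst_le _ _).1 le_rfl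
  have hf₂ : ∀ X, b ⊔ b' ≤ (f X).2 ∧ ∀ c ∈ u \ X, c.2 ≤ (f X).2 := fun X => (snd_le _ _).1 le_rfl
  have hu : ∀ X, ∀ c ∈ u, ∀ p ≤ c, p ∈ boxSet (f X).1 (f X).2 := fun X c hc p hp => by
    by_cases hX : c ∈ X
    · exact Or.inl (hp.1.trans ((hf₁ X).2 c hX))
    · exact Or.inr (hp.2.trans ((hf₂ X).2 c (Finset.mem_sdiff.2 ⟨hc, hX⟩)))
  refine ⟨u.powerset.image f, ⟨f ∅, Finset.mem_image_of_mem _ (by simp)⟩,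
    Set.Subset.antisymm ?_ ?_⟩
  · refine Set.subset_iInter₂ fun q hq => ?_
    obtain ⟨X, -, rfl⟩ := Finset.mem_image.1 hq
    refine Set.sInter_subset_of_mem ⟨isBoxInter_boxSet _ _, ?_, ?_⟩
    · rintro p (hp | ⟨c, hc, hp⟩)
      · exact boxSet_mono (le_sup_left.trans (hf₁ X).1) (le_sup_left.trans (hf₂ X).1) hp
      · exact hu X c (Finset.mem_union_left _ hc) p hp
    · rintro p (hp | ⟨c, hc, hp⟩)
      · exact boxSet_mono (le_sup_right.trans (hf₁ X).1) (le_sup_right.trans (hf₂ X).1) hp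
      · exact hu X c (Finset.mem_union_right _ hc) p hp
  · rintro p hp M ⟨⟨s, hs, rfl⟩, h₁, h₂⟩
    refine Set.mem_iInter₂.2 fun q hq => ?_
    have g₁ := h₁.trans (Set.biInter_subset_of_mem (t := fun p : A × B => boxSet p.1 p.2) hq)
    have g₂ := h₂.trans (Set.biInter_subset_of_mem (t := fun p : A × B => boxSet p.1 p.2) hq)
    by_contra hpq
    obtain ⟨hp₁, hp₂⟩ := not_or.1 hpq
    have ha : a ≤ q.1 := (g₁ (Or.inl (Or.inl le_rfl)) : (a, p.2) ∈ boxSet q.1 q.2).resolve_right hp₂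
    have ha' : a' ≤ q.1 :=
      (g₂ (Or.inl (Or.inl le_rfl)) : (a', p.2) ∈ boxSet q.1 q.2).resolve_right hp₂
    have hb : b ≤ q.2 := (g₁ (Or.inl (Or.inr le_rfl)) : (p.1, b) ∈ boxSet q.1 q.2).resolve_left hp₁
    have hb' : b' ≤ q.2 :=
      (g₂ (Or.inl (Or.inr le_rfl)) : (p.1, b') ∈ boxSet q.1 q.2).resolve_left hp₁
    have hq' : ∀ c ∈ u, c.1 ≤ q.1 ∨ c.2 ≤ q.2 := fun c hc => by
      rcases Finset.mem_union.1 hc with hc | hc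
      · exact g₁ (Or.inr ⟨c, hc, le_rfl⟩)
      · exact g₂ (Or.inr ⟨c, hc, le_rfl⟩)
    let X := u.filter fun c => c.1 ≤ q.1
    have hX : f X ∈ u.powerset.image f :=
      Finset.mem_image_of_mem _ (Finset.mem_powerset.2 (Finset.filter_subset _ _))
    have hpX : p ∈ boxSet (f X).1 (f X).2 := Set.mem_iInter₂.1 hp _ hX
    refine hpq (boxSet_mono ((fst_le _ _).2 ⟨sup_le ha ha', ?_⟩)
      ((snd_le _ _).2 ⟨sup_le hb hb', ?_⟩) hpX)
    · exact fun c hc => (Finset.mem_filter.1 hc).2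
    · intro c hc
      obtain ⟨hcu, hcX⟩ := Finset.mem_sdiff.1 hc
      exact (hq' c hcu).resolve_left fun h => hcX (Finset.mem_filter.2 ⟨hcu, h⟩)

variable (A B) in
/-- The box product `A □ B`. -/
def BoxProd := {H : Set (A × B) // IsBoxInter H}

/-- `A □ B` is a lattice with respect to containment. -/
instance : Lattice (BoxProd A B) where
  le H K := H.1 ⊆ K.1
  le_refl _ := Set.Subset.rfl
  le_trans _ _ _ h₁ h₂ := Set.Subset.trans h₁ h₂
  le_antisymm _ _ h₁ h₂ := Subtype.ext (Set.Subset.antisymm h₁ h₂)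
  inf H K := ⟨H.1 ∩ K.1, H.2.inter K.2⟩
  inf_le_left _ _ := Set.inter_subset_left
  inf_le_right _ _ := Set.inter_subset_right
  le_inf _ _ _ h₁ h₂ := Set.subset_inter h₁ h₂
  sup H K := ⟨boxClosure H.1 K.1, isBoxInter_boxClosure H.2 K.2⟩
  le_sup_left _ _ := Set.subset_sInter fun _ hM => hM.2.1
  le_sup_right _ _ := Set.subset_sInter fun _ hM => hM.2.2
  sup_le _ _ M h₁ h₂ := Set.sInter_subset_of_mem ⟨M.2, h₁, h₂⟩

/-- `a □ b` as an element of `A □ B`. -/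
def box (a : A) (b : B) : BoxProd A B := ⟨boxSet a b, isBoxInter_boxSet a b⟩

/-! ### The lattice tensor product -/

variable (A B) in
/-- The set `⊥_{A,B}` of all pairs having the zero of `A` or the zero of `B` as an entry; a lattice
without zero contributes nothing. -/
def tensorBot : Set (A × B) := {p | IsBot p.1 ∨ IsBot p.2}

/-- The set `a ⊠ b`. -/
def tensorSet (a : A) (b : B) : Set (A × B) := {p | p.1 ≤ a ∧ p.2 ≤ b} ∪ tensorBot A B

theorem tensorSet_mono {a a' : A} {b b' : B} (ha : a ≤ a') (hb : b ≤ b') :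
    tensorSet a b ⊆ tensorSet a' b' :=
  Set.union_subset_union_left _ fun _ h => ⟨h.1.trans ha, h.2.trans hb⟩

/-- An element of `A □ B` is confined if it is contained in some `a ⊠ b`. -/
def Confined (H : BoxProd A B) : Prop := ∃ (a : A) (b : B), H.1 ⊆ tensorSet a b

theorem tensorSet_eq_of_isBot {a o : A} {b z : B} (ho : IsBot o) (hz : IsBot z) :
    tensorSet a b = boxSet a z ∩ boxSet o b := by
  have h₁ : ∀ x : A, IsBot x ↔ x ≤ o := fun x => ⟨fun h => h o, fun h y => h.trans (ho y)⟩
  have h₂ : ∀ y : B, IsBot y ↔ y ≤ z := fun x => ⟨fun h => h z, fun h y => h.trans (hz y)⟩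
  ext ⟨x, y⟩
  simp only [tensorSet, tensorBot, boxSet, Set.mem_union, Set.mem_inter_iff, Set.mem_ofPred_eq, h₁, h₂]
  have h₃ : x ≤ o → x ≤ a := fun h => h.trans (ho a)
  have h₄ : y ≤ z → y ≤ b := fun h => h.trans (hz b)
  tauto

theorem tensorSet_eq_of_isBot_left {a o : A} {b : B} (ho : IsBot o) (ha : IsTop a) :
    tensorSet a b = boxSet o b := by
  have h₁ : ∀ x : A, IsBot x ↔ x ≤ o := fun x => ⟨fun h => h o, fun h y => h.trans (ho y)⟩
  ext ⟨x, y⟩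
  simp only [tensorSet, tensorBot, boxSet, Set.mem_union, Set.mem_ofPred_eq, h₁]
  have h₃ : x ≤ a := ha x
  have h₄ : IsBot y → y ≤ b := fun h => h b
  tauto

theorem tensorSet_eq_of_isBot_right {a : A} {b z : B} (hz : IsBot z) (hb : IsTop b) :
    tensorSet a b = boxSet a z := by
  have h₁ : ∀ x : B, IsBot x ↔ x ≤ z := fun x => ⟨fun h => h z, fun h y => h.trans (hz y)⟩
  ext ⟨x, y⟩
  simp only [tensorSet, tensorBot, boxSet, Set.mem_union, Set.mem_ofPred_eq, h₁]
  have h₃ : y ≤ b := hb y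
  have h₄ : IsBot x → x ≤ a := fun h => h a
  tauto

theorem isBoxInter_tensorSet_of_subset {a : A} {b : B} {H : Set (A × B)} (hH : IsBoxInter H)
    (h : H ⊆ tensorSet a b) : IsBoxInter (tensorSet a b) := by
  obtain ⟨u, v, t, rfl⟩ := hH.exists_union
  have top_left : (¬ ∃ z : B, IsBot z) → IsTop a := fun hB x => by
    rcases h (Or.inl (Or.inr le_rfl) : (x, v) ∈ _) with h' | h' | h'
    · exact h'.1
    · exact h' a
    · exact absurd ⟨_, h'⟩ hB
  have top_right : (¬ ∃ o : A, IsBot o) → IsTop b := fun hA y => by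
    rcases h (Or.inl (Or.inl le_rfl) : (u, y) ∈ _) with h' | h' | h'
    · exact h'.2
    · exact absurd ⟨_, h'⟩ hA
    · exact h' b
  by_cases hA : ∃ o : A, IsBot o <;> by_cases hB : ∃ z : B, IsBot z
  · obtain ⟨o, ho⟩ := hA
    obtain ⟨z, hz⟩ := hB
    rw [tensorSet_eq_of_isBot ho hz]
    exact (isBoxInter_boxSet _ _).inter (isBoxInter_boxSet _ _)
  · obtain ⟨o, ho⟩ := hA
    rw [tensorSet_eq_of_isBot_left ho (top_left hB)]
    exact isBoxInter_boxSet _ _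
  · obtain ⟨z, hz⟩ := hB
    rw [tensorSet_eq_of_isBot_right hz (top_right hA)]
    exact isBoxInter_boxSet _ _
  · have h₁ : tensorSet a b = boxSet a b := by
      ext p
      exact ⟨fun _ => Or.inl (top_left hB _), fun _ => Or.inl ⟨top_left hB _, top_right hA _⟩⟩
    rw [h₁]
    exact isBoxInter_boxSet _ _

variable (A B) in
/-- The set of all confined elements of `A □ B`, which is closed under joins and meets. -/
def confinedSublattice : Sublattice (BoxProd A B) where
  carrier := {H | Confined H}
  supClosed' := by
    rintro H ⟨a, b, hH⟩ K ⟨c, d, hK⟩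
    have hH' := hH.trans (tensorSet_mono (a' := a ⊔ c) (b' := b ⊔ d) le_sup_left le_sup_left)
    have hK' := hK.trans (tensorSet_mono (a' := a ⊔ c) (b' := b ⊔ d) le_sup_right le_sup_right)
    let M : BoxProd A B := ⟨_, isBoxInter_tensorSet_of_subset H.2 hH'⟩
    exact ⟨a ⊔ c, b ⊔ d, (sup_le hH' hK' : H ⊔ K ≤ M)⟩
  infClosed' := by
    rintro H ⟨a, b, hH⟩ K -
    exact ⟨a, b, Set.inter_subset_left.trans hH⟩

variable (A B) in
/-- The lattice tensor product `A ⊠ B`. -/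
abbrev LatticeTensor := ↥(confinedSublattice A B)

theorem confined_box_inf_of_bounded_left [BoundedOrder A] (a : A) (b b' : B) :
    box a b ⊓ box ⊥ b' ∈ confinedSublattice A B :=
  ⟨⊤, b', by
    rw [tensorSet_eq_of_isBot_left isBot_bot isTop_top]
    exact Set.inter_subset_right⟩

theorem confined_box_inf_of_bounded_right [BoundedOrder B] (a a' : A) (b : B) :
    box a b ⊓ box a' ⊥ ∈ confinedSublattice A B :=
  ⟨a', ⊤, by
    rw [tensorSet_eq_of_isBot_right isBot_bot isTop_top]
    exact Set.inter_subset_right⟩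

theorem confined_of_orderTop [OrderTop A] [OrderTop B] (H : BoxProd A B) :
    H ∈ confinedSublattice A B :=
  ⟨⊤, ⊤, fun _ _ => Or.inl ⟨le_top, le_top⟩⟩

/-- If `A` and `B` have a zero, then `a ⊠ b` is an element of `A ⊠ B`. -/
def LatticeTensor.tmul [OrderBot A] [OrderBot B] (a : A) (b : B) : LatticeTensor A B :=
  ⟨⟨tensorSet a b, by
      rw [tensorSet_eq_of_isBot isBot_bot isBot_bot]
      exact (isBoxInter_boxSet _ _).inter (isBoxInter_boxSet _ _)⟩,
    a, b, Set.Subset.rfl⟩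

end Box

/-!
# Compact congruences of a lattice tensor product

Write `L = A ⊠ B`. The isomorphism sends `x ∈ Conc A ⊗ Conc B` to the congruence `tensorCon x` of
`L` described as follows. For pairs `p` and `q`, the pure tensor
`boxDefect p q = Θ(p₁ ⊓ q₁, p₁) ⊗ Θ(p₂ ⊓ q₂, p₂)` measures by how much `p` fails to lie in
`q₁ □ q₂`, and `K ≤ H` modulo `tensorCon x` means that `boxDefect p q ≤ x` whenever `p ∈ K` and
`H ⊆ q₁ □ q₂`.

That this is an inequality modulo a congruence rests on the distributivity of congruence lattices,
through `SemilatticeTensor.pure_le_of_le_sup`: it allows `boxDefect p q` to be estimated by passing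
through a finite intersection of boxes (`boxDefect_le_of_inter`) or a finite union of sets
`{w | w ≤ r}` (`boxDefect_le_of_union`). Compatibility with joins also uses that an element of `L`
is, up to pairs with a zero entry, a finite union of the latter kind
(`LatticeTensor.exists_finset_generating`).

In the other direction, a congruence `ρ` of `L` has an ideal `tensorIdeal ρ` of `Conc A ⊗ Conc B`,
containing `boxDefect p q` exactly when `ρ` forces `p` into the box of `q`, which means that some
`N ∋ p` is below some `M ⊆ q₁ □ q₂` modulo `ρ`. It exists because for fixed second coordinates the
inequalities of first coordinates so forced are those of a congruence of `A`, and likewise for `B`.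
The two constructions are adjoint, `tensorCon x ≤ ρ ↔ x ∈ tensorIdeal ρ` (`tensorCon_le_iff`), and
`x ∈ tensorIdeal (tensorCon y) ↔ x ≤ y` (`mem_tensorIdeal_tensorCon`), so that `tensorCon` is an
order embedding. Since forcing has finite character its values are compact, and since an inequality
between two elements of `L` involves only finitely many pairs and boxes, every congruence is a
directed join of values; hence every compact congruence is a value.

No distinction is needed as to which zeros and units exist, except in the formulas for pure tensors,
which all follow from `tensorConIso_pure_eq`.
-/

/-! ### Inequalities modulo a congruence -/

namespace LatticeCon

variable {L : Type*} [Lattice L]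

/-- `θ.Below x y` says that `x ≤ y` holds modulo `θ`, i.e. that the class of `x` is below the class
of `y` in the quotient lattice `L / θ`. -/
def Below (θ : LatticeCon L) (x y : L) : Prop := θ.r (x ⊓ y) x

namespace Below

variable {θ ψ : LatticeCon L} {x y z : L}

theorem of_le (h : x ≤ y) : θ.Below x y := by
  rw [Below, inf_eq_left.2 h]

theorem of_rel (h : θ.r x y) : θ.Below x y := by
  simpa [Below] using θ.inf (θ.refl x) (θ.symm h)

theorem mono (hθ : θ ≤ ψ) (h : θ.Below x y) : ψ.Below x y := hθ h

theorem trans (h₁ : θ.Below x y) (h₂ : θ.Below y z) : θ.Below x z := by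
  have h₃ : θ.r (x ⊓ y ⊓ z) (x ⊓ y) := by
    simpa [inf_assoc] using θ.inf (θ.refl x) h₂
  exact θ.trans (θ.inf (θ.symm h₁) (θ.refl z)) (θ.trans h₃ h₁)

theorem antisymm (h₁ : θ.Below x y) (h₂ : θ.Below y x) : θ.r x y := by
  have h₂' : θ.r (x ⊓ y) y := by rw [inf_comm]; exact h₂
  exact θ.trans (θ.symm h₁) h₂'

theorem sup (h₁ : θ.Below x z) (h₂ : θ.Below y z) : θ.Below (x ⊔ y) z := by
  have h : θ.r (x ⊓ z ⊔ y ⊓ z ⊔ z) (x ⊔ y ⊔ z) := θ.sup (θ.sup h₁ h₂) (θ.refl z)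
  rw [sup_eq_right.2 (sup_le inf_le_right inf_le_right)] at h
  simpa [Below] using θ.inf (θ.refl (x ⊔ y)) h

theorem inf (h₁ : θ.Below x y) (h₂ : θ.Below x z) : θ.Below x (y ⊓ z) := by
  have h := θ.inf h₁ h₂
  rwa [inf_inf_inf_comm, inf_idem] at h

end Below

theorem le_iff_below {θ ψ : LatticeCon L} : θ ≤ ψ ↔ ∀ x y, θ.Below x y → ψ.Below x y :=
  ⟨fun h _ _ => Below.mono h, fun h x y hxy =>
    (h x y (.of_rel hxy)).antisymm (h y x (.of_rel (θ.symm hxy)))⟩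

/-- A relation with the formal properties of an inequality modulo a congruence is one; the
congruence identifies `x` and `y` when each is below the other. -/
theorem exists_below_iff (R : L → L → Prop) (of_le : ∀ {x y}, x ≤ y → R x y)
    (trans : ∀ {x y z}, R x y → R y z → R x z) (sup : ∀ {x y z}, R x z → R y z → R (x ⊔ y) z)
    (inf : ∀ {x y z}, R x y → R x z → R x (y ⊓ z)) :
    ∃ θ : LatticeCon L, ∀ x y, θ.Below x y ↔ R x y :=
  ⟨{ r := fun x y => R x y ∧ R y x
     iseqv :=
      { refl := fun _ => ⟨of_le le_rfl, of_le le_rfl⟩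
        symm := And.symm
        trans := fun h₁ h₂ => ⟨trans h₁.1 h₂.1, trans h₂.2 h₁.2⟩ }
     inf := fun h₁ h₂ =>
      ⟨inf (trans (of_le inf_le_left) h₁.1) (trans (of_le inf_le_right) h₂.1),
        inf (trans (of_le inf_le_left) h₁.2) (trans (of_le inf_le_right) h₂.2)⟩
     sup := fun h₁ h₂ =>
      ⟨sup (trans h₁.1 (of_le le_sup_left)) (trans h₂.1 (of_le le_sup_right)),
        sup (trans h₁.2 (of_le le_sup_left)) (trans h₂.2 (of_le le_sup_right))⟩ },
    fun _ _ => ⟨fun h => trans h.2 (of_le inf_le_right),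
      fun h => ⟨of_le inf_le_left, inf (of_le le_rfl) h⟩⟩⟩

/-! ### Distributivity of the congruence lattice -/

/-- The join of two congruences is contained in the equivalence relation generated by their
union, since the latter is compatible with the lattice operations. -/
theorem eqvGen_of_sup {θ ψ : LatticeCon L} {x y : L} (h : (θ ⊔ ψ).r x y) :
    Relation.EqvGen (fun x y => θ.r x y ∨ ψ.r x y) x y := by
  let R : L → L → Prop := Relation.EqvGen fun x y => θ.r x y ∨ ψ.r x y
  have map : ∀ (f : L → L), (∀ χ : LatticeCon L, ∀ x y, χ.r x y → χ.r (f x) (f y)) →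
      ∀ x y, R x y → R (f x) (f y) := by
    intro f hf x y hxy
    induction hxy with
    | rel x y h => exact .rel _ _ (h.imp (hf θ x y) (hf ψ x y))
    | refl x => exact .refl _
    | symm x y _ ih => exact .symm _ _ ih
    | trans x y z _ _ ih₁ ih₂ => exact .trans _ _ _ ih₁ ih₂
  let χ : LatticeCon L :=
    { r := R
      iseqv := Relation.EqvGen.is_equivalence _
      inf := fun {w x y z} h₁ h₂ => .trans _ _ _
        (map (· ⊓ y) (fun χ _ _ h => χ.inf h (χ.refl y)) _ _ h₁)
        (map (x ⊓ ·) (fun χ _ _ h => χ.inf (χ.refl x) h) _ _ h₂)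
      sup := fun {w x y z} h₁ h₂ => .trans _ _ _
        (map (· ⊔ y) (fun χ _ _ h => χ.sup h (χ.refl y)) _ _ h₁)
        (map (x ⊔ ·) (fun χ _ _ h => χ.sup (χ.refl x) h) _ _ h₂) }
  have hθ : θ ≤ χ := fun _ _ h => .rel _ _ (.inl h)
  have hψ : ψ ≤ χ := fun _ _ h => .rel _ _ (.inr h)
  exact sup_le hθ hψ h

/-- The congruence lattice is distributive: if `x` and `y` are congruent modulo `α` and joined by a
sequence of steps in `θ` and `ψ`, then the images of that sequence under the majority term
`z ↦ m(x, z, y)` run from `x` to `y` within a single class of `α`. -/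
theorem inf_sup_le (α θ ψ : LatticeCon L) : α ⊓ (θ ⊔ ψ) ≤ α ⊓ θ ⊔ α ⊓ ψ := by
  intro x y h
  have hα : α.r x y := (inf_le_left : α ⊓ (θ ⊔ ψ) ≤ α) h
  have hG := eqvGen_of_sup ((inf_le_right : α ⊓ (θ ⊔ ψ) ≤ θ ⊔ ψ) h)
  -- The majority term in its middle argument: it fixes `x` and `y`, and is constant modulo `α`.
  let m : L → L := fun z => (x ⊓ z) ⊔ (z ⊓ y) ⊔ (x ⊓ y)
  have hm : ∀ (χ : LatticeCon L) {z w : L}, χ.r z w → χ.r (m z) (m w) := fun χ z w h =>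
    χ.sup (χ.sup (χ.inf (χ.refl x) h) (χ.inf h (χ.refl y))) (χ.refl _)
  have hmα : ∀ z, α.r (m z) x := fun z => by
    have := α.sup (α.sup (α.refl (x ⊓ z)) (α.inf (α.refl z) (α.symm hα)))
      (α.inf (α.refl x) (α.symm hα))
    refine α.trans this ?_
    rw [inf_idem, inf_comm z x, sup_idem, sup_eq_right.2 inf_le_left]
  have hmm : ∀ z w, α.r (m z) (m w) := fun z w => α.trans (hmα z) (α.symm (hmα w))
  have mem_inf : ∀ {χ : LatticeCon L} {z w : L}, α.r z w → χ.r z w → (α ⊓ χ).r z w := by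
    intro χ z w h₁ h₂
    have : principal z w ≤ α ⊓ χ := le_inf (principal_le_iff.2 h₁) (principal_le_iff.2 h₂)
    exact principal_le_iff.1 this
  have key : ∀ z w, Relation.EqvGen (fun x y => θ.r x y ∨ ψ.r x y) z w →
      (α ⊓ θ ⊔ α ⊓ ψ).r (m z) (m w) := by
    intro z w hzw
    induction hzw with
    | rel z w h =>
      rcases h with h | h
      · exact (le_sup_left : α ⊓ θ ≤ α ⊓ θ ⊔ α ⊓ ψ) (mem_inf (hmm z w) (hm θ h))
      · exact (le_sup_right : α ⊓ ψ ≤ α ⊓ θ ⊔ α ⊓ ψ) (mem_inf (hmm z w) (hm ψ h))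
    | refl z => exact (α ⊓ θ ⊔ α ⊓ ψ).toSetoid.refl _
    | symm z w _ ih => exact (α ⊓ θ ⊔ α ⊓ ψ).toSetoid.symm ih
    | trans z w v _ _ ih₁ ih₂ => exact (α ⊓ θ ⊔ α ⊓ ψ).toSetoid.trans ih₁ ih₂
  have hx : m x = x := by
    simp only [m, inf_idem]
    rw [sup_assoc, sup_idem, sup_eq_left.2 inf_le_left]
  have hy : m y = y := by
    simp only [m, inf_idem]
    rw [sup_eq_right.2 (inf_le_right : x ⊓ y ≤ y), sup_eq_left.2 inf_le_right]
  simpa only [hx, hy] using key x y hG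

theorem le_sSup_principal (θ : LatticeCon L) :
    θ ≤ sSup {χ | ∃ x y, x ≤ y ∧ θ.r x y ∧ χ = principal x y} := by
  intro x y h
  have h' : principal (x ⊓ y) (x ⊔ y) ≤ sSup {χ | ∃ x y, x ≤ y ∧ θ.r x y ∧ χ = principal x y} :=
    le_sSup ⟨_, _, inf_le_sup, (θ.r_inf_sup_iff).2 h, rfl⟩
  exact (LatticeCon.r_inf_sup_iff _).1 (principal_le_iff.1 h')

instance : IsCompactlyGenerated (LatticeCon L) where
  exists_sSup_eq θ := by
    refine ⟨{χ | ∃ x y, x ≤ y ∧ θ.r x y ∧ χ = principal x y}, ?_,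
      le_antisymm (sSup_le ?_) θ.le_sSup_principal⟩
    · rintro _ ⟨x, y, -, -, rfl⟩
      exact isCompactElement_principal x y
    · rintro _ ⟨x, y, -, h, rfl⟩
      exact principal_le_iff.2 h

end LatticeCon

/-! ### The semilattice of compact congruences -/

namespace Conc

variable {L : Type*} [Lattice L]

/-- Every compact congruence is a finite join of principal ones. -/
theorem induction_on {P : Conc L → Prop} (bot : P ⊥)
    (principal : ∀ x y, x ≤ y → P (principal x y)) (sup : ∀ α β, P α → P β → P (α ⊔ β))
    (α : Conc L) : P α := by
  classical
  obtain ⟨θ, hθ⟩ := α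
  obtain ⟨t, ht, hle⟩ :=
    (CompleteLattice.isCompactElement_iff_exists_le_sSup_of_le_sSup _ _).1 hθ _ θ.le_sSup_principal
  have h : ∀ u ⊆ t, ∃ α : Conc L, α.1 = u.sup id ∧ P α := by
    intro u
    induction u using Finset.induction_on with
    | empty => exact fun _ => ⟨⊥, rfl, bot⟩
    | insert χ u _ ih =>
      intro hu
      obtain ⟨β, hβ, hPβ⟩ := ih ((Finset.subset_insert _ _).trans hu)
      obtain ⟨x, y, hxy, -, rfl⟩ := ht (Finset.mem_coe.2 (hu (Finset.mem_insert_self _ _)))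
      refine ⟨Conc.principal x y ⊔ β, ?_, sup _ _ (principal x y hxy) hPβ⟩
      rw [Finset.sup_insert, ← hβ]
      rfl
  obtain ⟨α, hα, hP⟩ := h t subset_rfl
  have : α = ⟨θ, hθ⟩ := by
    refine Subtype.ext (hα.trans (le_antisymm (Finset.sup_le fun χ hχ => ?_) hle))
    obtain ⟨x, y, -, hr, rfl⟩ := ht (Finset.mem_coe.2 hχ)
    exact LatticeCon.principal_le_iff.2 hr
  exact this ▸ hP

/-- `Conc L` is a distributive semilattice: a compact congruence below a join of two others is a
join of parts lying below them. -/
theorem exists_sup_of_le_sup {α β γ : Conc L} (h : α ≤ β ⊔ γ) :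
    ∃ β' ≤ β, ∃ γ' ≤ γ, α = β' ⊔ γ' := by
  let S : Set (LatticeCon L) :=
    {χ | ∃ β' γ' : Conc L, β' ≤ β ∧ γ' ≤ γ ∧ β' ≤ α ∧ γ' ≤ α ∧ χ = (β' ⊔ γ').1}
  have hS : DirectedOn (· ≤ ·) S := by
    rintro _ ⟨β₁, γ₁, h₁, h₂, h₃, h₄, rfl⟩ _ ⟨β₂, γ₂, h₅, h₆, h₇, h₈, rfl⟩
    refine ⟨_, ⟨β₁ ⊔ β₂, γ₁ ⊔ γ₂, sup_le h₁ h₅, sup_le h₂ h₆, sup_le h₃ h₇, sup_le h₄ h₈, rfl⟩,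
      ?_, ?_⟩
    · exact (sup_le_sup le_sup_left le_sup_left : β₁ ⊔ γ₁ ≤ β₁ ⊔ β₂ ⊔ (γ₁ ⊔ γ₂))
    · exact (sup_le_sup le_sup_right le_sup_right : β₂ ⊔ γ₂ ≤ β₁ ⊔ β₂ ⊔ (γ₁ ⊔ γ₂))
  have hle : α.1 ≤ sSup S := by
    have h₁ : α.1 ≤ α.1 ⊓ β.1 ⊔ α.1 ⊓ γ.1 :=
      (le_inf le_rfl (h : α.1 ≤ β.1 ⊔ γ.1)).trans (LatticeCon.inf_sup_le _ _ _)
    refine h₁.trans (sup_le ?_ ?_) <;>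
      refine le_iff_compact_le_imp.2 fun χ hχ hle => le_sSup ?_
    all_goals let χ' : Conc L := ⟨χ, hχ⟩
    · exact ⟨χ', ⊥, hle.trans inf_le_right, bot_le, hle.trans inf_le_left, bot_le,
        congrArg Subtype.val (sup_bot_eq χ').symm⟩
    · exact ⟨⊥, χ', bot_le, hle.trans inf_le_right, bot_le, hle.trans inf_le_left,
        congrArg Subtype.val (bot_sup_eq χ').symm⟩
  obtain ⟨_, ⟨β', γ', h₁, h₂, h₃, h₄, rfl⟩, hα⟩ :=
    α.2 S _ ⟨_, ⊥, ⊥, bot_le, bot_le, bot_le, bot_le, rfl⟩ hS (isLUB_sSup S) hle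
  exact ⟨β', h₁, γ', h₂, le_antisymm hα (sup_le h₃ h₄)⟩

/-- The least congruence modulo which `x ≤ y`. -/
def defect (x y : L) : Conc L := principal (x ⊓ y) x

theorem defect_le_iff {x y : L} {α : Conc L} : defect x y ≤ α ↔ α.1.Below x y :=
  LatticeCon.principal_le_iff

theorem below_defect (x y : L) : (defect x y).1.Below x y := defect_le_iff.1 le_rfl

theorem principal_eq_defect {x y : L} (h : x ≤ y) : principal x y = defect y x := by
  rw [defect, inf_eq_right.2 h]

theorem defect_eq_bot {x y : L} (h : x ≤ y) : defect x y = ⊥ :=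
  le_bot_iff.1 (defect_le_iff.2 (.of_le h))

theorem defect_mono {x x' y y' : L} (hx : x ≤ x') (hy : y' ≤ y) : defect x y ≤ defect x' y' :=
  defect_le_iff.2 <| (LatticeCon.Below.of_le hx).trans <| (below_defect x' y').trans <| .of_le hy

theorem defect_le_sup_defect (x y z : L) : defect x z ≤ defect x y ⊔ defect y z :=
  defect_le_iff.2 <|
    LatticeCon.Below.trans (.mono (le_sup_left : (defect x y).1 ≤ _ ⊔ _) (below_defect x y))
      (.mono (le_sup_right : (defect y z).1 ≤ _ ⊔ _) (below_defect y z))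

theorem defect_inf_right (x y : L) : defect x (x ⊓ y) = defect x y := by
  simp [defect]

theorem defect_sup_left (x y : L) : defect (x ⊔ y) y = defect x y :=
  le_antisymm (defect_le_iff.2 ((below_defect x y).sup (.of_le le_rfl)))
    (defect_mono le_sup_left le_rfl)

end Conc

/-! ### Pure tensors -/

namespace SemilatticeTensor

variable {S T : Type*} [SemilatticeSup S] [OrderBot S] [SemilatticeSup T] [OrderBot T]

/-- The join of `S ⊗ T`, read off its semilattice structure. That structure is built by
`SemilatticeSup.mk'`, so its join is not reducibly equal to the given `Max` instance; with this
instance preferred, `⊔` is the join to which the lemmas on semilattices apply. -/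
instance instMaxOfSemilatticeSup : Max (SemilatticeTensor S T) := SemilatticeSup.toMax

@[simp] theorem pure_bot_left (b : T) : pure (⊥ : S) b = ⊥ := by simp [pure]

@[simp] theorem pure_bot_right (a : S) : pure a (⊥ : T) = ⊥ := by simp [pure]

theorem pure_sup_left (a a' : S) (b : T) : pure (a ⊔ a') b = pure a b ⊔ pure a' b := by
  rcases eq_or_ne b ⊥ with rfl | hb
  · simp
  rcases eq_or_ne a ⊥ with rfl | ha
  · simp
  rcases eq_or_ne a' ⊥ with rfl | ha'
  · simp
  have h : a ⊔ a' ≠ ⊥ := fun h => ha (sup_eq_bot_iff.1 h).1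
  simp only [pure, ha, ha', hb, h, ne_eq, not_false_eq_true, and_self, dite_true]
  exact (Quotient.sound (TensorRel.gen_left _ _ _ _ rfl)).symm

theorem pure_sup_right (a : S) (b b' : T) : pure a (b ⊔ b') = pure a b ⊔ pure a b' := by
  rcases eq_or_ne a ⊥ with rfl | ha
  · simp
  rcases eq_or_ne b ⊥ with rfl | hb
  · simp
  rcases eq_or_ne b' ⊥ with rfl | hb'
  · simp
  have h : b ⊔ b' ≠ ⊥ := fun h => hb (sup_eq_bot_iff.1 h).1
  simp only [pure, ha, hb', hb, h, ne_eq, not_false_eq_true, and_self, dite_true]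
  exact (Quotient.sound (TensorRel.gen_right _ _ _ _ rfl)).symm

theorem pure_mono {a a' : S} {b b' : T} (ha : a ≤ a') (hb : b ≤ b') : pure a b ≤ pure a' b' := by
  rw [← sup_eq_right.2 ha, ← sup_eq_right.2 hb, pure_sup_left, pure_sup_right a']
  simp only [pure_sup_right]
  exact le_sup_left.trans le_sup_left

theorem induction_on {P : SemilatticeTensor S T → Prop} (bot : P ⊥) (pure : ∀ a b, P (pure a b))
    (sup : ∀ x y, P x → P y → P (x ⊔ y)) (x : SemilatticeTensor S T) : P x := by
  obtain ⟨x⟩ := x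
  change P (mk x)
  induction x with
  | zero => exact bot
  | gen a b =>
    have h := pure a b
    rwa [SemilatticeTensor.pure, dif_pos ⟨a.2, b.2⟩] at h
  | sup x y hx hy => exact sup _ _ hx hy

/-- A relation closed under joins in each variable determines an ideal of `S ⊗ T`, consisting of
the finite joins of the pure tensors `a ⊗ b` with `P a b`, which contains no further pure tensor. -/
theorem exists_ideal (P : S → T → Prop) (bot_left : ∀ b, P ⊥ b) (bot_right : ∀ a, P a ⊥)
    (sup_left : ∀ a a' b, P (a ⊔ a') b ↔ P a b ∧ P a' b)
    (sup_right : ∀ a b b', P a (b ⊔ b') ↔ P a b ∧ P a b') :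
    ∃ I : Order.Ideal (SemilatticeTensor S T), ∀ a b, pure a b ∈ I ↔ P a b := by
  let f : TensorTerm S T → Prop :=
    TensorTerm.rec True (fun a b => P a b) (fun _ _ p q => p ∧ q)
  have hf : ∀ x y : TensorTerm S T, TensorRel x y → f x = f y := by
    intro x y h
    rw [eq_iff_iff]
    induction h with
    | refl x => exact Iff.rfl
    | symm _ ih => exact ih.symm
    | trans _ _ ih₁ ih₂ => exact ih₁.trans ih₂
    | congr _ _ ih₁ ih₂ => exact and_congr ih₁ ih₂
    | comm x y => exact and_comm
    | assoc x y z => exact and_assoc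
    | idem x => exact and_self_iff
    | zero_sup x => exact iff_of_eq (true_and _)
    | gen_right a b₀ b₁ b hb =>
      change P a b₀ ∧ P a b₁ ↔ P a b
      rw [← hb, sup_right]
    | gen_left a₀ a₁ a b ha =>
      change P a₀ b ∧ P a₁ b ↔ P a b
      rw [← ha, sup_left]
  let I : Set (SemilatticeTensor S T) := {x | Quotient.lift f hf x}
  have bot : ⊥ ∈ I := trivial
  have sup : ∀ x y, x ⊔ y ∈ I ↔ x ∈ I ∧ y ∈ I := by
    rintro ⟨x⟩ ⟨y⟩
    exact Iff.rfl
  have lower : IsLowerSet I := fun x y hyx hx => by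
    rw [← sup_eq_left.2 hyx] at hx
    exact ((sup x y).1 hx).2
  refine ⟨⟨⟨I, lower⟩, ⟨⊥, bot⟩, fun x hx y hy =>
    ⟨x ⊔ y, (sup x y).2 ⟨hx, hy⟩, le_sup_left, le_sup_right⟩⟩, fun a b => ?_⟩
  change pure a b ∈ I ↔ P a b
  by_cases h : a ≠ ⊥ ∧ b ≠ ⊥
  · rw [pure, dif_pos h]
    exact Iff.rfl
  · rw [pure, dif_neg h]
    refine iff_of_true trivial ?_
    rcases not_and_or.1 h with h | h
    · rw [not_not.1 h]; exact bot_left b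
    · rw [not_not.1 h]; exact bot_right a

/-- A consequence of the distributivity of `Conc L`: the part of `a` below `a₂` is tensored with all
of `b`, and for the part below `a₁` one divides `b`. -/
theorem pure_le_of_le_sup {L : Type*} [Lattice L] {a a₁ a₂ : Conc L} {b b₁ b₂ : T}
    {x : SemilatticeTensor (Conc L) T} (ha : a ≤ a₁ ⊔ a₂) (hb : b ≤ b₁ ⊔ b₂)
    (h₁ : pure a₁ b₁ ≤ x) (h₂ : pure a₂ b ≤ x) (h₃ : pure a b₂ ≤ x) : pure a b ≤ x := by
  obtain ⟨a₁', h₁', a₂', h₂', rfl⟩ := Conc.exists_sup_of_le_sup ha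
  rw [pure_sup_left]
  refine sup_le ?_ ((pure_mono h₂' le_rfl).trans h₂)
  calc pure a₁' b ≤ pure a₁' (b₁ ⊔ b₂) := pure_mono le_rfl hb
    _ = pure a₁' b₁ ⊔ pure a₁' b₂ := pure_sup_right _ _ _
    _ ≤ x := sup_le ((pure_mono h₁' le_rfl).trans h₁) ((pure_mono le_sup_left le_rfl).trans h₃)

end SemilatticeTensor

/-! ### Failure of membership in a box -/

section Box

variable {A B : Type*} [Lattice A] [Lattice B]

/-- The pure tensor measuring by how much the pair `p` fails to lie in the box `q.1 □ q.2`: it is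
zero for `p` in the box. -/
noncomputable def boxDefect (p q : A × B) : SemilatticeTensor (Conc A) (Conc B) :=
  .pure (Conc.defect p.1 q.1) (Conc.defect p.2 q.2)

theorem boxDefect_eq_bot {p q : A × B} (h : p ∈ boxSet q.1 q.2) : boxDefect p q = ⊥ := by
  rcases h with h | h <;> simp [boxDefect, Conc.defect_eq_bot h]

theorem boxDefect_mono {p p' q q' : A × B} (hp : p ≤ p') (hq : q' ≤ q) :
    boxDefect p q ≤ boxDefect p' q' :=
  SemilatticeTensor.pure_mono (Conc.defect_mono hp.1 hq.1) (Conc.defect_mono hp.2 hq.2)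

theorem mem_boxSet_of_mem_tensorBot {p : A × B} (hp : p ∈ tensorBot A B) (a : A) (b : B) :
    p ∈ boxSet a b := hp.imp (fun h => h a) fun h => h b

theorem mem_boxSet_of_le {p p' : A × B} (hp : p ≤ p') {a : A} {b : B} (h : p' ∈ boxSet a b) :
    p ∈ boxSet a b := h.imp hp.1.trans hp.2.trans

/-- The failure of `p` to lie in a box is bounded through the elements below `p` of a finite
intersection of boxes. -/
theorem boxDefect_le_of_inter {x : SemilatticeTensor (Conc A) (Conc B)} {q : A × B}
    (s : Finset (A × B)) (p : A × B) (h₁ : ∀ r ∈ s, boxDefect p r ≤ x)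
    (h₂ : ∀ z ≤ p, (∀ r ∈ s, z ∈ boxSet r.1 r.2) → boxDefect z q ≤ x) : boxDefect p q ≤ x := by
  classical
  induction s using Finset.induction_on generalizing p with
  | empty => exact h₂ p le_rfl (by simp)
  | insert r s _ ih =>
    have hs : ∀ z ≤ p, z ∈ boxSet r.1 r.2 → boxDefect z q ≤ x := fun z hz hr =>
      ih z (fun r' hr' => (boxDefect_mono hz le_rfl).trans (h₁ r' (Finset.mem_insert_of_mem hr')))
        fun w hw hws => h₂ w (hw.trans hz) <| by
          simpa using ⟨mem_boxSet_of_le hw hr, fun a b hab => hws (a, b) hab⟩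
    -- Lowering either coordinate of `p` to that of `r` yields a pair in the box of `r`.
    refine SemilatticeTensor.pure_le_of_le_sup (Conc.defect_le_sup_defect p.1 (p.1 ⊓ r.1) q.1)
      (Conc.defect_le_sup_defect p.2 (p.2 ⊓ r.2) q.2) ?_
      (hs (p.1 ⊓ r.1, p.2) ⟨inf_le_left, le_rfl⟩ (.inl inf_le_right)) ?_
    · rw [Conc.defect_inf_right, Conc.defect_inf_right]
      exact h₁ r (Finset.mem_insert_self _ _)
    · exact hs (p.1, p.2 ⊓ r.2) ⟨le_rfl, inf_le_left⟩ (.inr inf_le_right)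

/-- The failure of `p` to lie in the box of `q` is bounded through the boxes containing both that
box and a given finite set of pairs. -/
theorem boxDefect_le_of_union {x : SemilatticeTensor (Conc A) (Conc B)} {p : A × B}
    (t : Finset (A × B)) (q : A × B) (h₁ : ∀ r ∈ t, boxDefect r q ≤ x)
    (h₂ : ∀ z ≥ q, (∀ r ∈ t, r ∈ boxSet z.1 z.2) → boxDefect p z ≤ x) : boxDefect p q ≤ x := by
  classical
  induction t using Finset.induction_on generalizing q with
  | empty => exact h₂ q le_rfl (by simp)
  | insert r t _ ih =>
    have ht : ∀ z ≥ q, r ∈ boxSet z.1 z.2 → boxDefect p z ≤ x := fun z hz hr =>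
      ih z (fun r' hr' => (boxDefect_mono le_rfl hz).trans (h₁ r' (Finset.mem_insert_of_mem hr')))
        fun w hw hwt => h₂ w (hz.le.trans hw) <| by
          simpa using ⟨boxSet_mono hw.1 hw.2 hr, fun a b hab => hwt (a, b) hab⟩
    -- Raising either coordinate of `q` by that of `r` yields a box containing `r`.
    refine SemilatticeTensor.pure_le_of_le_sup
      ((Conc.defect_le_sup_defect p.1 (q.1 ⊔ r.1) q.1).trans_eq (sup_comm _ _))
      ((Conc.defect_le_sup_defect p.2 (q.2 ⊔ r.2) q.2).trans_eq (sup_comm _ _)) ?_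
      (ht (q.1 ⊔ r.1, q.2) ⟨le_sup_left, le_rfl⟩ (.inl le_sup_right)) ?_
    · rw [sup_comm, Conc.defect_sup_left, sup_comm, Conc.defect_sup_left]
      exact h₁ r (Finset.mem_insert_self _ _)
    · exact ht (q.1, q.2 ⊔ r.2) ⟨le_rfl, le_sup_left⟩ (.inr le_sup_right)

/-! ### Elements of the lattice tensor product -/

namespace IsBoxInter

variable {H : Set (A × B)}

theorem mem_of_forall (hH : IsBoxInter H) {p : A × B}
    (h : ∀ q : A × B, H ⊆ boxSet q.1 q.2 → p ∈ boxSet q.1 q.2) : p ∈ H := by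
  obtain ⟨s, -, rfl⟩ := hH
  exact Set.mem_iInter₂.2 fun q hq => h q (Set.biInter_subset_of_mem hq)

theorem mem_of_le (hH : IsBoxInter H) {p p' : A × B} (hp : p ≤ p') (h : p' ∈ H) : p ∈ H :=
  hH.mem_of_forall fun _ hq => mem_boxSet_of_le hp (hq h)

theorem mem_of_mem_tensorBot (hH : IsBoxInter H) {p : A × B} (hp : p ∈ tensorBot A B) : p ∈ H :=
  hH.mem_of_forall fun _ _ => mem_boxSet_of_mem_tensorBot hp _ _

theorem sup_left_mem (hH : IsBoxInter H) {a a' : A} {b : B} (h : (a, b) ∈ H) (h' : (a', b) ∈ H) :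
    (a ⊔ a', b) ∈ H := by
  refine hH.mem_of_forall fun q hq => ?_
  rcases hq h with h | h
  · exact (hq h').imp (sup_le h) id
  · exact .inr h

theorem sup_right_mem (hH : IsBoxInter H) {a : A} {b b' : B} (h : (a, b) ∈ H) (h' : (a, b') ∈ H) :
    (a, b ⊔ b') ∈ H := by
  refine hH.mem_of_forall fun q hq => ?_
  rcases hq h with h | h
  · exact .inl h
  · exact (hq h').imp id (sup_le h)

end IsBoxInter

namespace LatticeTensor

/-- The set of pairs underlying an element of `A ⊠ B`. -/
def toSet (H : LatticeTensor A B) : Set (A × B) := H.1.1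

theorem isBoxInter (H : LatticeTensor A B) : IsBoxInter H.toSet := H.1.2

theorem sup_subset_boxSet {H K : LatticeTensor A B} {a : A} {b : B} (hH : H.toSet ⊆ boxSet a b)
    (hK : K.toSet ⊆ boxSet a b) : (H ⊔ K).toSet ⊆ boxSet a b :=
  (sup_le hH hK : H.1 ⊔ K.1 ≤ box a b)

/-- An element of `A ⊠ B`, unlike one of `A □ B`, is generated by finitely many of its pairs: all
its other pairs lie below these or have a zero as an entry. -/
theorem exists_finset_generating (H : LatticeTensor A B) :
    ∃ t : Finset (A × B), (∀ p ∈ t, p ∈ H.toSet) ∧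
      ∀ p ∈ H.toSet, p ∈ tensorBot A B ∨ ∃ q ∈ t, p ≤ q := by
  classical
  obtain ⟨⟨H, hH⟩, a, b, hab⟩ := H
  obtain ⟨u, v, t, rfl⟩ := hH.exists_union
  refine ⟨insert (u, b) (insert (a, v) t), ?_, fun p hp => ?_⟩
  · simp only [Finset.mem_insert, forall_eq_or_imp]
    exact ⟨.inl (.inl le_rfl), .inl (.inr le_rfl), fun p hp => .inr ⟨p, hp, le_rfl⟩⟩
  · -- A pair in `u □ v` and in `a ⊠ b` is below `(u, b)` or `(a, v)`, or has a zero entry.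
    rcases hab hp with h | h
    · refine .inr ?_
      rcases hp with (h' | h') | ⟨c, hc, hpc⟩
      · exact ⟨(u, b), by simp, h', h.2⟩
      · exact ⟨(a, v), by simp, h.1, h'⟩
      · exact ⟨c, by simp [hc], hpc⟩
    · exact .inl h

/-- The intersection of an element of `A ⊠ B` with a box. -/
def cut (H : LatticeTensor A B) (q : A × B) : LatticeTensor A B :=
  ⟨H.1 ⊓ box q.1 q.2,
    let ⟨a, b, h⟩ := H.2
    ⟨a, b, Set.inter_subset_left.trans h⟩⟩

theorem cut_le (H : LatticeTensor A B) (q : A × B) : H.cut q ≤ H := Set.inter_subset_left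

/-- Once `A ⊠ B` is nonempty, all sufficiently large sets `a ⊠ b` are among its elements. -/
theorem exists_eq_tensorSet (hne : Nonempty (LatticeTensor A B)) (p : A × B) :
    ∃ (a : A) (b : B) (N : LatticeTensor A B), p.1 ≤ a ∧ p.2 ≤ b ∧ N.toSet = tensorSet a b := by
  obtain ⟨H, a, b, h⟩ := hne
  refine ⟨p.1 ⊔ a, p.2 ⊔ b, ⟨⟨tensorSet (p.1 ⊔ a) (p.2 ⊔ b), ?_⟩, _, _, subset_rfl⟩,
    le_sup_left, le_sup_left, rfl⟩
  exact isBoxInter_tensorSet_of_subset H.2 (h.trans (tensorSet_mono le_sup_right le_sup_right))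

end LatticeTensor

/-! ### The congruence attached to an element of the tensor product -/

open LatticeTensor

/-- The inclusion of `K` in `H` up to `x`: the failure of any pair of `K` to lie in any box
containing `H` is at most `x`. -/
def BoxBelow (x : SemilatticeTensor (Conc A) (Conc B)) (K H : Set (A × B)) : Prop :=
  ∀ p ∈ K, ∀ q : A × B, H ⊆ boxSet q.1 q.2 → boxDefect p q ≤ x

namespace BoxBelow

variable {x : SemilatticeTensor (Conc A) (Conc B)}

theorem mono {y : SemilatticeTensor (Conc A) (Conc B)} (hxy : x ≤ y) {K H : Set (A × B)}
    (h : BoxBelow x K H) : BoxBelow y K H :=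
  fun p hp q hq => (h p hp q hq).trans hxy

theorem of_subset {K H : Set (A × B)} (h : K ⊆ H) : BoxBelow x K H := fun _ hp _ hq =>
  (boxDefect_eq_bot (hq (h hp))).trans_le bot_le

theorem trans {K M H : Set (A × B)} (hM : IsBoxInter M) (h₁ : BoxBelow x K M)
    (h₂ : BoxBelow x M H) : BoxBelow x K H := by
  obtain ⟨s, -, rfl⟩ := hM
  exact fun p hp q hq => boxDefect_le_of_inter s p
    (fun r hr => h₁ p hp r (Set.biInter_subset_of_mem hr))
    fun z _ hz => h₂ z (Set.mem_iInter₂.2 hz) q hq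

theorem inf {K H H' : Set (A × B)} (hH : IsBoxInter H) (hH' : IsBoxInter H')
    (h : BoxBelow x K H) (h' : BoxBelow x K H') : BoxBelow x K (H ∩ H') := by
  classical
  obtain ⟨s, -, rfl⟩ := hH
  obtain ⟨s', -, rfl⟩ := hH'
  refine fun p hp q hq => boxDefect_le_of_inter (s ∪ s') p (fun r hr => ?_) fun z _ hz => ?_
  · rcases Finset.mem_union.1 hr with hr | hr
    · exact h p hp r (Set.biInter_subset_of_mem hr)
    · exact h' p hp r (Set.biInter_subset_of_mem hr)
  · refine (boxDefect_eq_bot (hq ⟨?_, ?_⟩)).trans_le bot_le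
    · exact Set.mem_iInter₂.2 fun r hr => hz r (Finset.mem_union_left _ hr)
    · exact Set.mem_iInter₂.2 fun r hr => hz r (Finset.mem_union_right _ hr)

theorem sup {K K' : LatticeTensor A B} {H : Set (A × B)} (h : BoxBelow x K.toSet H)
    (h' : BoxBelow x K'.toSet H) : BoxBelow x (K ⊔ K').toSet H := by
  classical
  obtain ⟨t, ht, hK⟩ := K.exists_finset_generating
  obtain ⟨t', ht', hK'⟩ := K'.exists_finset_generating
  refine fun p hp q hq => boxDefect_le_of_union (t ∪ t') q (fun r hr => ?_) fun z _ hz => ?_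
  · rcases Finset.mem_union.1 hr with hr | hr
    · exact h r (ht r hr) q hq
    · exact h' r (ht' r hr) q hq
  · refine (boxDefect_eq_bot (sup_subset_boxSet (fun r hr => ?_) (fun r hr => ?_) hp)).trans_le
      bot_le
    · rcases hK r hr with hr | ⟨w, hw, hrw⟩
      · exact mem_boxSet_of_mem_tensorBot hr _ _
      · exact mem_boxSet_of_le hrw (hz w (Finset.mem_union_left _ hw))
    · rcases hK' r hr with hr | ⟨w, hw, hrw⟩
      · exact mem_boxSet_of_mem_tensorBot hr _ _
      · exact mem_boxSet_of_le hrw (hz w (Finset.mem_union_right _ hw))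

end BoxBelow

theorem exists_below_iff_boxBelow (x : SemilatticeTensor (Conc A) (Conc B)) :
    ∃ θ : LatticeCon (LatticeTensor A B), ∀ K H, θ.Below K H ↔ BoxBelow x K.toSet H.toSet :=
  LatticeCon.exists_below_iff _ (fun h => BoxBelow.of_subset h)
    (fun {_ M _} h₁ h₂ => h₁.trans M.isBoxInter h₂) BoxBelow.sup
    fun {_ H H'} h₁ h₂ => h₁.inf H.isBoxInter H'.isBoxInter h₂

/-- The congruence of `A ⊠ B` that identifies two elements included in each other up to `x`. -/
noncomputable def tensorCon (x : SemilatticeTensor (Conc A) (Conc B)) :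
    LatticeCon (LatticeTensor A B) := (exists_below_iff_boxBelow x).choose

theorem below_tensorCon {x : SemilatticeTensor (Conc A) (Conc B)} {K H : LatticeTensor A B} :
    (tensorCon x).Below K H ↔ BoxBelow x K.toSet H.toSet :=
  (exists_below_iff_boxBelow x).choose_spec K H

theorem tensorCon_mono {x y : SemilatticeTensor (Conc A) (Conc B)} (h : x ≤ y) :
    tensorCon x ≤ tensorCon y :=
  LatticeCon.le_iff_below.2 fun _ _ hKH => below_tensorCon.2 ((below_tensorCon.1 hKH).mono h)

/-! ### The ideal attached to a congruence of the lattice tensor product -/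

/-- The congruence `ρ` forces the pair `p` into the box `q.1 □ q.2`: some element of `A ⊠ B`
containing `p` is, modulo `ρ`, below an element contained in the box. This formulation does not
require the box to be an element of `A ⊠ B`, nor `p` to generate one. -/
def ForcesMem (ρ : LatticeCon (LatticeTensor A B)) (p q : A × B) : Prop :=
  ∃ N M : LatticeTensor A B, p ∈ N.toSet ∧ M.toSet ⊆ boxSet q.1 q.2 ∧ ρ.Below N M

namespace ForcesMem

variable {ρ : LatticeCon (LatticeTensor A B)}

theorem mono {ρ' : LatticeCon (LatticeTensor A B)} (h : ρ ≤ ρ') {p q : A × B}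
    (hpq : ForcesMem ρ p q) : ForcesMem ρ' p q := by
  obtain ⟨N, M, hN, hM, hNM⟩ := hpq
  exact ⟨N, M, hN, hM, hNM.mono h⟩

theorem of_mem (hne : Nonempty (LatticeTensor A B)) {p q : A × B} (h : p ∈ boxSet q.1 q.2) :
    ForcesMem ρ p q := by
  obtain ⟨a, b, N, ha, hb, hN⟩ := exists_eq_tensorSet hne p
  refine ⟨N.cut q, N.cut q, ⟨?_, h⟩, Set.inter_subset_right, .of_le le_rfl⟩
  exact hN.ge (.inl ⟨ha, hb⟩)

/-- Transitivity in one coordinate, in a form covering both: the pairs of `r.1 □ r.2` that lie in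
the auxiliary box of `s` are below the pair `z` or in the box of `q`. -/
theorem trans_of_subset {p q r z s : A × B} (h₁ : ForcesMem ρ p r) (h₂ : ForcesMem ρ z q)
    (hs : p ∈ boxSet s.1 s.2)
    (hrs : ∀ w ∈ boxSet r.1 r.2, w ∈ boxSet s.1 s.2 → w ∈ boxSet q.1 q.2 ∨ w ≤ z) :
    ForcesMem ρ p q := by
  obtain ⟨N₁, M₁, hN₁, hM₁, h₁⟩ := h₁
  obtain ⟨N₂, M₂, hN₂, hM₂, h₂⟩ := h₂
  -- Modulo `ρ`, the part of `N₁` in the box of `s` is below `K`; what of `K` is not in the box of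
  -- `q` lies below `z`, hence in `N₂`.
  let K := M₁ ⊓ N₁.cut s
  have hK : K ≤ N₂ ⊔ K.cut q := fun w hw => by
    rcases hrs w (hM₁ hw.1) hw.2.2 with h | h
    · exact (le_sup_right : K.cut q ≤ N₂ ⊔ K.cut q) ⟨hw, h⟩
    · exact (le_sup_left : N₂ ≤ N₂ ⊔ K.cut q) (N₂.isBoxInter.mem_of_le h hN₂)
  refine ⟨N₁.cut s, M₂ ⊔ K.cut q, ⟨hN₁, hs⟩,
    sup_subset_boxSet hM₂ Set.inter_subset_right, ?_⟩
  have h₃ : ρ.Below (N₁.cut s) K := ((LatticeCon.Below.of_le (cut_le _ _)).trans h₁).inf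
    (.of_le le_rfl)
  exact (h₃.trans (.of_le hK)).trans
    ((h₂.trans (.of_le le_sup_left)).sup (.of_le le_sup_right))

end ForcesMem

/-- For a fixed pair `b, d`, the inequalities `a ≤ c` such that `ρ` forces `(a, b)` into `c □ d`
are those of a congruence of `A`. -/
theorem exists_below_iff_forcesMem_left (ρ : LatticeCon (LatticeTensor A B))
    (hne : Nonempty (LatticeTensor A B)) (b d : B) :
    ∃ θ : LatticeCon A, ∀ a c, θ.Below a c ↔ ForcesMem ρ (a, b) (c, d) := by
  refine LatticeCon.exists_below_iff (fun a c => ForcesMem ρ (a, b) (c, d))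
    (fun h => .of_mem hne (.inl h))
    (fun {x y z} h₁ h₂ => h₁.trans_of_subset h₂ (s := (z, b)) (.inr le_rfl) ?_) ?_ ?_
  · rintro w (h | h) (h' | h')
    · exact .inl (.inl h')
    · exact .inr ⟨h, h'⟩
    · exact .inl (.inr h)
    · exact .inl (.inr h)
  · rintro x y z ⟨N, M, hN, hM, h⟩ ⟨N', M', hN', hM', h'⟩
    exact ⟨N ⊔ N', M ⊔ M', (N ⊔ N').isBoxInter.sup_left_mem
      ((le_sup_left : N ≤ N ⊔ N') hN) ((le_sup_right : N' ≤ N ⊔ N') hN'),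
      sup_subset_boxSet hM hM',
      (h.trans (.of_le le_sup_left)).sup (h'.trans (.of_le le_sup_right))⟩
  · rintro x y z ⟨N, M, hN, hM, h⟩ ⟨N', M', hN', hM', h'⟩
    refine ⟨N ⊓ N', M ⊓ M', ⟨hN, hN'⟩, fun w hw => ?_,
      ((LatticeCon.Below.of_le inf_le_left).trans h).inf
        ((LatticeCon.Below.of_le inf_le_right).trans h')⟩
    rcases hM hw.1 with h₁ | h₁
    · exact (hM' hw.2).imp (le_inf h₁) id
    · exact .inr h₁

/-- The counterpart of `exists_below_iff_forcesMem_left` for the second coordinate. -/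
theorem exists_below_iff_forcesMem_right (ρ : LatticeCon (LatticeTensor A B))
    (hne : Nonempty (LatticeTensor A B)) (a c : A) :
    ∃ θ : LatticeCon B, ∀ b d, θ.Below b d ↔ ForcesMem ρ (a, b) (c, d) := by
  refine LatticeCon.exists_below_iff (fun b d => ForcesMem ρ (a, b) (c, d))
    (fun h => .of_mem hne (.inr h))
    (fun {x y z} h₁ h₂ => h₁.trans_of_subset h₂ (s := (a, z)) (.inl le_rfl) ?_) ?_ ?_
  · rintro w (h | h) (h' | h')
    · exact .inl (.inl h)
    · exact .inl (.inl h)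
    · exact .inr ⟨h', h⟩
    · exact .inl (.inr h')
  · rintro x y z ⟨N, M, hN, hM, h⟩ ⟨N', M', hN', hM', h'⟩
    exact ⟨N ⊔ N', M ⊔ M', (N ⊔ N').isBoxInter.sup_right_mem
      ((le_sup_left : N ≤ N ⊔ N') hN) ((le_sup_right : N' ≤ N ⊔ N') hN'),
      sup_subset_boxSet hM hM',
      (h.trans (.of_le le_sup_left)).sup (h'.trans (.of_le le_sup_right))⟩
  · rintro x y z ⟨N, M, hN, hM, h⟩ ⟨N', M', hN', hM', h'⟩
    refine ⟨N ⊓ N', M ⊓ M', ⟨hN, hN'⟩, fun w hw => ?_,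
      ((LatticeCon.Below.of_le inf_le_left).trans h).inf
        ((LatticeCon.Below.of_le inf_le_right).trans h')⟩
    rcases hM hw.1 with h₁ | h₁
    · exact .inl h₁
    · exact (hM' hw.2).imp id (le_inf h₁)

/-- The relation `P α β` of the proof says that `ρ` forces `(a, b)` into `c □ d` whenever `a ≤ c`
modulo `α` and `b ≤ d` modulo `β`. For fixed `β` this bounds `α` by congruences of `A`, and for
fixed `α` it bounds `β` by congruences of `B`, so that `P` is closed under joins in each variable. -/
theorem exists_ideal_forcesMem (ρ : LatticeCon (LatticeTensor A B))
    (hne : Nonempty (LatticeTensor A B)) :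
    ∃ I : Order.Ideal (SemilatticeTensor (Conc A) (Conc B)),
      ∀ p q, boxDefect p q ∈ I ↔ ForcesMem ρ p q := by
  choose θ hθ using fun b d => exists_below_iff_forcesMem_left ρ hne b d
  choose ψ hψ using fun a c => exists_below_iff_forcesMem_right ρ hne a c
  let P : Conc A → Conc B → Prop := fun α β =>
    ∀ a c b d, α.1.Below a c → β.1.Below b d → ForcesMem ρ (a, b) (c, d)
  have left : ∀ α β, P α β ↔ ∀ b d, β.1.Below b d → α.1 ≤ θ b d := fun α β =>
    ⟨fun h b d hbd => LatticeCon.le_iff_below.2 fun a c hac => (hθ b d a c).2 (h a c b d hac hbd),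
      fun h a c b d hac hbd => (hθ b d a c).1 (hac.mono (h b d hbd))⟩
  have right : ∀ α β, P α β ↔ ∀ a c, α.1.Below a c → β.1 ≤ ψ a c := fun α β =>
    ⟨fun h a c hac => LatticeCon.le_iff_below.2 fun b d hbd => (hψ a c b d).2 (h a c b d hac hbd),
      fun h a c b d hac hbd => (hψ a c b d).1 (hbd.mono (h a c hac))⟩
  obtain ⟨I, hI⟩ := SemilatticeTensor.exists_ideal P
    (fun β => (left _ _).2 fun _ _ _ => bot_le) (fun α => (right _ _).2 fun _ _ _ => bot_le)
    (fun α α' β => by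
      simp only [left, ← forall_and]
      exact forall₃_congr fun b d _ => (sup_le_iff : α.1 ⊔ α'.1 ≤ _ ↔ _))
    (fun α β β' => by
      simp only [right, ← forall_and]
      exact forall₃_congr fun a c _ => (sup_le_iff : β.1 ⊔ β'.1 ≤ _ ↔ _))
  refine ⟨I, fun p q => (hI _ _).trans ⟨fun h => ?_, fun h => ?_⟩⟩
  · exact h _ _ _ _ (Conc.below_defect _ _) (Conc.below_defect _ _)
  · refine (left _ _).2 fun b d hbd => ?_
    have h₁ : (Conc.defect p.2 q.2).1 ≤ ψ p.1 q.1 :=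
      LatticeCon.principal_le_iff.2 ((hψ _ _ _ _).2 h)
    exact LatticeCon.principal_le_iff.2 ((hθ _ _ _ _).2 ((hψ _ _ _ _).1 (hbd.mono h₁)))

/-- The ideal of `Conc A ⊗ Conc B` attached to a congruence `ρ` of `A ⊠ B`. By
`boxDefect_mem_tensorIdeal` and `boxDefect_induction`, it is the only ideal containing exactly those
`boxDefect p q` for which `ρ` forces `p` into the box of `q`. -/
noncomputable def tensorIdeal (hne : Nonempty (LatticeTensor A B))
    (ρ : LatticeCon (LatticeTensor A B)) : Order.Ideal (SemilatticeTensor (Conc A) (Conc B)) :=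
  (exists_ideal_forcesMem ρ hne).choose

section TensorIdeal

variable {hne : Nonempty (LatticeTensor A B)} {ρ : LatticeCon (LatticeTensor A B)}

theorem boxDefect_mem_tensorIdeal {p q : A × B} :
    boxDefect p q ∈ tensorIdeal hne ρ ↔ ForcesMem ρ p q :=
  (exists_ideal_forcesMem ρ hne).choose_spec p q

/-- `Conc A ⊗ Conc B` is generated by the pure tensors of principal congruences. -/
theorem boxDefect_induction {P : SemilatticeTensor (Conc A) (Conc B) → Prop} (bot : P ⊥)
    (boxDefect : ∀ p q, P (boxDefect p q)) (sup : ∀ x y, P x → P y → P (x ⊔ y))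
    (x : SemilatticeTensor (Conc A) (Conc B)) : P x := by
  induction x using SemilatticeTensor.induction_on with
  | bot => exact bot
  | sup x y hx hy => exact sup x y hx hy
  | pure α β =>
    induction α using Conc.induction_on with
    | bot => simpa using bot
    | sup α α' h h' => rw [SemilatticeTensor.pure_sup_left]; exact sup _ _ h h'
    | principal a c hac =>
      induction β using Conc.induction_on with
      | bot => simpa using bot
      | sup β β' h h' => rw [SemilatticeTensor.pure_sup_right]; exact sup _ _ h h'
      | principal b d hbd =>
        rw [Conc.principal_eq_defect hac, Conc.principal_eq_defect hbd]
        exact boxDefect (c, d) (a, b)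

theorem tensorIdeal_mono {ρ' : LatticeCon (LatticeTensor A B)} (h : ρ ≤ ρ') :
    tensorIdeal hne ρ ≤ tensorIdeal hne ρ' := by
  intro x
  change x ∈ tensorIdeal hne ρ → x ∈ tensorIdeal hne ρ'
  induction x using boxDefect_induction with
  | bot => exact fun _ => Order.Ideal.bot_mem _
  | boxDefect p q => simpa only [boxDefect_mem_tensorIdeal] using ForcesMem.mono h
  | sup x y hx hy => simpa only [Order.Ideal.sup_mem_iff] using And.imp hx hy

/-- If `ρ` forces each pair of `N` into each box containing `M`, then `N ≤ M` modulo `ρ`. -/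
theorem below_of_forall_forcesMem {N M : LatticeTensor A B}
    (h : ∀ p ∈ N.toSet, ∀ q : A × B, M.toSet ⊆ boxSet q.1 q.2 → ForcesMem ρ p q) :
    ρ.Below N M := by
  classical
  have h₁ : ∀ p ∈ N.toSet, ∃ K : LatticeTensor A B, p ∈ K.toSet ∧ ρ.Below K M := by
    intro p hp
    obtain ⟨s, hs, hM⟩ := M.isBoxInter
    have hq : ∀ q ∈ s, ForcesMem ρ p q := fun q hq =>
      h p hp q <| hM.trans_subset <|
        Set.biInter_subset_of_mem (t := fun q : A × B => boxSet q.1 q.2) hq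
    have : ∃ K M' : LatticeTensor A B, p ∈ K.toSet ∧ M'.toSet ⊆ ⋂ q ∈ s, boxSet q.1 q.2 ∧
        ρ.Below K M' := by
      clear hM
      induction hs using Finset.Nonempty.cons_induction with
      | singleton q => simpa [ForcesMem] using hq q
      | cons q s hqs hs ih =>
        obtain ⟨K, M', hK, hM', hKM⟩ := ih fun r hr => hq r (Finset.mem_cons_of_mem hr)
        obtain ⟨K', M'', hK', hM'', hKM'⟩ := hq q (Finset.mem_cons_self _ _)
        refine ⟨K' ⊓ K, M'' ⊓ M', ⟨hK', hK⟩, ?_, ?_⟩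
        · have : (M'' ⊓ M').toSet ⊆ boxSet q.1 q.2 ∩ ⋂ q ∈ s, boxSet q.1 q.2 :=
            Set.inter_subset_inter hM'' hM'
          simpa using this
        · exact ((LatticeCon.Below.of_le inf_le_left).trans hKM').inf
            ((LatticeCon.Below.of_le inf_le_right).trans hKM)
    obtain ⟨K, M', hK, hM', hKM⟩ := this
    rw [← hM] at hM'
    exact ⟨K, hK, hKM.trans (.of_le hM')⟩
  obtain ⟨t, ht, hN⟩ := N.exists_finset_generating
  have h₂ : ∃ K : LatticeTensor A B, (∀ p ∈ t, p ∈ K.toSet) ∧ ρ.Below K M := by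
    clear hN
    induction t using Finset.induction_on with
    | empty => exact ⟨M, by simp, .of_le le_rfl⟩
    | insert p t _ ih =>
      obtain ⟨K, hK, hKM⟩ := ih fun r hr => ht r (Finset.mem_insert_of_mem hr)
      obtain ⟨K', hK', hKM'⟩ := h₁ p (ht p (Finset.mem_insert_self _ _))
      refine ⟨K' ⊔ K, fun r hr => ?_, hKM'.sup hKM⟩
      rcases Finset.mem_insert.1 hr with rfl | hr
      · exact (le_sup_left : K' ≤ K' ⊔ K) hK'
      · exact (le_sup_right : K ≤ K' ⊔ K) (hK r hr)
  obtain ⟨K, hK, hKM⟩ := h₂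
  have hNK : N ≤ K := fun p hp => by
    rcases hN p hp with h | ⟨r, hr, hpr⟩
    · exact K.isBoxInter.mem_of_mem_tensorBot h
    · exact K.isBoxInter.mem_of_le hpr (hK r hr)
  exact (LatticeCon.Below.of_le hNK).trans hKM

theorem tensorCon_le_of_mem_tensorIdeal {x : SemilatticeTensor (Conc A) (Conc B)}
    (hx : x ∈ tensorIdeal hne ρ) : tensorCon x ≤ ρ :=
  LatticeCon.le_iff_below.2 fun _ _ hNM => below_of_forall_forcesMem fun p hp q hq =>
    boxDefect_mem_tensorIdeal.1
      ((tensorIdeal hne ρ).lower (below_tensorCon.1 hNM p hp q hq) hx)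

/-- The congruence of `x` forces `p` into the box of `q` exactly when the failure of `p` to lie
there is at most `x`. The witness for the converse is the intersection of a sufficiently large `a ⊠ b`
with the two boxes obtained by raising one coordinate of `q` by that of `p`; both contain `p`, and
both turn into the box of `q` modulo the congruences `defect p.1 q.1` and `defect p.2 q.2`. -/
theorem forcesMem_tensorCon_iff (hne : Nonempty (LatticeTensor A B))
    {x : SemilatticeTensor (Conc A) (Conc B)} {p q : A × B} :
    ForcesMem (tensorCon x) p q ↔ boxDefect p q ≤ x := by
  constructor
  · rintro ⟨N, M, hN, hM, hNM⟩
    exact below_tensorCon.1 hNM p hN q hM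
  · intro h
    obtain ⟨a, b, K, ha, hb, hK⟩ := exists_eq_tensorSet hne p
    have hsub : ∀ u v, u ≤ a → v ≤ b → (u, v) ∈ K.toSet := fun u v hu hv => by
      rw [hK]; exact .inl ⟨hu, hv⟩
    refine ⟨(K.cut (q.1 ⊔ p.1, q.2)).cut (q.1, q.2 ⊔ p.2), K.cut q,
      ⟨⟨hsub _ _ ha hb, .inl le_sup_right⟩, .inr le_sup_right⟩, Set.inter_subset_right,
      below_tensorCon.2 ?_⟩
    rintro w ⟨⟨hwK, hw₁⟩, hw₂⟩ r hr
    suffices w ∈ boxSet r.1 r.2 ∨ boxDefect w r ≤ boxDefect p q by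
      rcases this with h' | h'
      · exact (boxDefect_eq_bot h').trans_le bot_le
      · exact h'.trans h
    by_cases hwq : w ∈ boxSet q.1 q.2
    · exact .inl (hr ⟨hwK, hwq⟩)
    rcases hK.le hwK with hwab | hw
    · have h₁ : w.1 ≤ q.1 ⊔ p.1 := hw₁.resolve_right fun h => hwq (.inr h)
      have h₂ : w.2 ≤ q.2 ⊔ p.2 := hw₂.resolve_left fun h => hwq (.inl h)
      rcases hr (⟨hsub (a ⊓ q.1) b inf_le_left le_rfl, .inl inf_le_right⟩ :
        (a ⊓ q.1, b) ∈ (K.cut q).toSet) with h₃ | h₃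
      · rcases hr (⟨hsub a (b ⊓ q.2) le_rfl inf_le_left, .inr inf_le_right⟩ :
          (a, b ⊓ q.2) ∈ (K.cut q).toSet) with h₄ | h₄
        · exact .inl (.inl (hwab.1.trans h₄))
        · refine .inr (SemilatticeTensor.pure_mono (Conc.defect_le_iff.2 ?_)
            (Conc.defect_le_iff.2 ?_))
          · exact ((LatticeCon.Below.of_le hwab.1).inf ((LatticeCon.Below.of_le h₁).trans
              ((LatticeCon.Below.of_le le_rfl).sup (Conc.below_defect _ _)))).trans (.of_le h₃)
          · exact ((LatticeCon.Below.of_le hwab.2).inf ((LatticeCon.Below.of_le h₂).trans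
              ((LatticeCon.Below.of_le le_rfl).sup (Conc.below_defect _ _)))).trans (.of_le h₄)
      · exact .inl (.inr (hwab.2.trans h₃))
    · exact .inl (mem_boxSet_of_mem_tensorBot hw _ _)

theorem mem_tensorIdeal_tensorCon {x y : SemilatticeTensor (Conc A) (Conc B)} :
    x ∈ tensorIdeal hne (tensorCon y) ↔ x ≤ y := by
  induction x using boxDefect_induction with
  | bot => exact iff_of_true (Order.Ideal.bot_mem _) bot_le
  | boxDefect p q => rw [boxDefect_mem_tensorIdeal, forcesMem_tensorCon_iff hne]
  | sup x y hx hy => rw [Order.Ideal.sup_mem_iff, sup_le_iff, hx, hy]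

theorem tensorCon_le_iff {x : SemilatticeTensor (Conc A) (Conc B)} :
    tensorCon x ≤ ρ ↔ x ∈ tensorIdeal hne ρ :=
  ⟨fun h => tensorIdeal_mono h (mem_tensorIdeal_tensorCon.2 le_rfl),
    tensorCon_le_of_mem_tensorIdeal⟩

theorem tensorCon_le_tensorCon_iff (hne : Nonempty (LatticeTensor A B))
    {x y : SemilatticeTensor (Conc A) (Conc B)} : tensorCon x ≤ tensorCon y ↔ x ≤ y :=
  (tensorCon_le_iff (hne := hne)).trans mem_tensorIdeal_tensorCon

theorem isCompactElement_tensorCon (hne : Nonempty (LatticeTensor A B))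
    (x : SemilatticeTensor (Conc A) (Conc B)) : IsCompactElement (tensorCon x) := by
  intro S u hS hdir hu hle
  have hub : u ≤ LatticeCon.directedUnion S hS hdir := hu.2 fun θ hθ _ _ h => ⟨θ, hθ, h⟩
  have hx := (tensorCon_le_iff (hne := hne)).1 (hle.trans hub)
  simp only [tensorCon_le_iff (hne := hne)]
  clear hle
  induction x using boxDefect_induction with
  | bot => exact hS.imp fun θ hθ => ⟨hθ, Order.Ideal.bot_mem _⟩
  | boxDefect p q =>
    obtain ⟨N, M, hN, hM, θ, hθ, h⟩ := boxDefect_mem_tensorIdeal.1 hx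
    exact ⟨θ, hθ, boxDefect_mem_tensorIdeal.2 ⟨N, M, hN, hM, h⟩⟩
  | sup x y ihx ihy =>
    obtain ⟨θ, hθ, hxθ⟩ := ihx (Order.Ideal.sup_mem_iff.1 hx).1
    obtain ⟨ψ, hψ, hyψ⟩ := ihy (Order.Ideal.sup_mem_iff.1 hx).2
    obtain ⟨χ, hχ, h₁, h₂⟩ := hdir θ hθ ψ hψ
    exact ⟨χ, hχ, Order.Ideal.sup_mem (tensorIdeal_mono h₁ hxθ) (tensorIdeal_mono h₂ hyψ)⟩

/-- Each inequality modulo `ρ` already holds modulo the congruence of some `x` in the ideal of `ρ`,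
namely the join of the failures of finitely many generating pairs to lie in finitely many boxes. -/
theorem exists_below_tensorCon {N M : LatticeTensor A B} (h : ρ.Below N M) :
    ∃ x ∈ tensorIdeal hne ρ, (tensorCon x).Below N M := by
  obtain ⟨t, ht, hN⟩ := N.exists_finset_generating
  obtain ⟨s, -, hM⟩ := M.isBoxInter
  let x := (t ×ˢ s).sup fun r => boxDefect r.1 r.2
  have hx : ∀ p ∈ t, ∀ r ∈ s, boxDefect p r ≤ x := fun p hp r hr =>
    Finset.le_sup (f := fun r : (A × B) × A × B => boxDefect r.1 r.2) (b := (p, r))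
      (Finset.mem_product.2 ⟨hp, hr⟩)
  refine ⟨x, ?_, below_tensorCon.2 fun p hp q hq => boxDefect_le_of_inter s p (fun r hr => ?_)
    fun z _ hz => ?_⟩
  · refine Finset.sup_induction (p := (· ∈ tensorIdeal hne ρ)) (Order.Ideal.bot_mem _)
      (fun _ h₁ _ h₂ => Order.Ideal.sup_mem h₁ h₂) fun r hr => boxDefect_mem_tensorIdeal.2 ?_
    rw [Finset.mem_product] at hr
    exact ⟨N, M, ht _ hr.1, hM.trans_subset
      (Set.biInter_subset_of_mem (t := fun q : A × B => boxSet q.1 q.2) hr.2), h⟩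
  · rcases hN p hp with hp | ⟨p', hp', hpp'⟩
    · exact (boxDefect_eq_bot (mem_boxSet_of_mem_tensorBot hp _ _)).trans_le bot_le
    · exact (boxDefect_mono hpp' le_rfl).trans (hx p' hp' r hr)
  · refine (boxDefect_eq_bot (hq ?_)).trans_le bot_le
    rw [hM]
    exact Set.mem_iInter₂.2 hz

theorem exists_tensorCon_eq (hne : Nonempty (LatticeTensor A B)) (hρ : IsCompactElement ρ) :
    ∃ x, tensorCon x = ρ := by
  let S : Set (LatticeCon (LatticeTensor A B)) := tensorCon '' {x | x ∈ tensorIdeal hne ρ}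
  have hS : DirectedOn (· ≤ ·) S := by
    rintro _ ⟨x, hx, rfl⟩ _ ⟨y, hy, rfl⟩
    exact ⟨_, ⟨x ⊔ y, Order.Ideal.sup_mem hx hy, rfl⟩, tensorCon_mono le_sup_left,
      tensorCon_mono le_sup_right⟩
  have hle : ρ ≤ sSup S := LatticeCon.le_iff_below.2 fun N M h => by
    obtain ⟨x, hx, hNM⟩ := exists_below_tensorCon (hne := hne) h
    exact hNM.mono (le_sSup ⟨x, hx, rfl⟩)
  obtain ⟨_, ⟨x, hx, rfl⟩, h⟩ :=
    hρ S _ ⟨_, ⊥, Order.Ideal.bot_mem _, rfl⟩ hS (isLUB_sSup S) hle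
  exact ⟨x, le_antisymm (tensorCon_le_of_mem_tensorIdeal hx) h⟩

end TensorIdeal

/-! ### The isomorphism -/

/-- The map `x ↦ tensorCon x` as an isomorphism of `Conc A ⊗ Conc B` onto `Conc (A ⊠ B)`. An order
isomorphism preserves joins and zero, hence is an isomorphism of semilattices. -/
noncomputable def tensorConIso (hne : Nonempty (LatticeTensor A B)) :
    SemilatticeTensor (Conc A) (Conc B) ≃o Conc (LatticeTensor A B) :=
  RelIso.ofSurjective
    (OrderEmbedding.ofMapLEIff
      (fun x => (⟨tensorCon x, isCompactElement_tensorCon hne x⟩ : Conc (LatticeTensor A B)))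
      fun _ _ => tensorCon_le_tensorCon_iff hne)
    fun ρ => (exists_tensorCon_eq hne ρ.2).imp fun _ h => Subtype.ext h

/-- A criterion for the congruence of `Θ(a₀, a₁) ⊗ Θ(b₀, b₁)` to be `Θ(H, K)`. The conditions `hH`
and `hK` say that `Θ(H, K)` forces `(a₁, b₁)` into `a₀ □ b₀`; by `h`, a pair of `K` outside a box
containing `H` fails to lie in it by no more than `(a₁, b₁)` fails to lie in `a₀ □ b₀`. -/
theorem tensorConIso_pure_eq (hne : Nonempty (LatticeTensor A B)) {a₀ a₁ : A} {b₀ b₁ : B}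
    (ha : a₀ ≤ a₁) (hb : b₀ ≤ b₁) {H K : LatticeTensor A B} (hHK : H ≤ K)
    (hH : H.toSet ⊆ boxSet a₀ b₀) (hK : (a₁, b₁) ∈ K.toSet)
    (h : ∀ x y c d, (x, y) ∈ K.toSet → H.toSet ⊆ boxSet c d →
      (x ≤ c ∨ y ≤ d) ∨ ((x ≤ a₁ ∧ a₀ ≤ c) ∧ y ≤ b₁ ∧ b₀ ≤ d)) :
    tensorConIso hne (.pure (Conc.principal a₀ a₁) (Conc.principal b₀ b₁)) =
      Conc.principal H K := by
  rw [Conc.principal_eq_defect ha, Conc.principal_eq_defect hb, Conc.principal_eq_defect hHK]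
  change tensorConIso hne (boxDefect (a₁, b₁) (a₀, b₀)) = _
  refine le_antisymm ?_ (Conc.defect_le_iff.2 (below_tensorCon.2 ?_))
  · exact (tensorCon_le_iff (hne := hne)).2
      (boxDefect_mem_tensorIdeal.2 ⟨K, H, hK, hH, Conc.below_defect K H⟩)
  · rintro ⟨x, y⟩ hxy ⟨c, d⟩ hcd
    rcases h x y c d hxy hcd with h | ⟨h₁, h₂⟩
    · exact (boxDefect_eq_bot h).trans_le bot_le
    · exact boxDefect_mono ⟨h₁.1, h₂.1⟩ ⟨h₁.2, h₂.2⟩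

end Box

theorem theorem7 {A : Type*} {B : Type*} [Lattice A] [Lattice B]
    (hne : Nonempty (LatticeTensor A B)) :
    ∃ μ : SemilatticeTensor (Conc A) (Conc B) ≃o Conc (LatticeTensor A B),
      -- both lattices have a zero
      (∀ [OrderBot A] [OrderBot B] (a₀ a₁ : A) (b₀ b₁ : B), a₀ ≤ a₁ → b₀ ≤ b₁ →
        μ (SemilatticeTensor.pure (Conc.principal a₀ a₁) (Conc.principal b₀ b₁)) =
          Conc.principal
            (LatticeTensor.tmul a₀ b₁ ⊔ LatticeTensor.tmul a₁ b₀)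
            (LatticeTensor.tmul a₁ b₁)) ∧
      -- the first lattice is bounded
      (∀ [BoundedOrder A] (a₀ a₁ : A) (b₀ b₁ : B), a₀ ≤ a₁ → b₀ ≤ b₁ →
        μ (SemilatticeTensor.pure (Conc.principal a₀ a₁) (Conc.principal b₀ b₁)) =
          Conc.principal (L := LatticeTensor A B)
            ⟨box a₀ b₀ ⊓ box ⊥ b₁, confined_box_inf_of_bounded_left a₀ b₀ b₁⟩
            ⟨box a₁ b₀ ⊓ box ⊥ b₁, confined_box_inf_of_bounded_left a₁ b₀ b₁⟩) ∧
      -- the second lattice is bounded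
      (∀ [BoundedOrder B] (a₀ a₁ : A) (b₀ b₁ : B), a₀ ≤ a₁ → b₀ ≤ b₁ →
        μ (SemilatticeTensor.pure (Conc.principal a₀ a₁) (Conc.principal b₀ b₁)) =
          Conc.principal (L := LatticeTensor A B)
            ⟨box a₀ b₀ ⊓ box a₁ ⊥, confined_box_inf_of_bounded_right a₀ a₁ b₀⟩
            ⟨box a₀ b₁ ⊓ box a₁ ⊥, confined_box_inf_of_bounded_right a₀ a₁ b₁⟩) ∧
      -- both lattices have a unit
      (∀ [OrderTop A] [OrderTop B] (a₀ a₁ : A) (b₀ b₁ : B), a₀ ≤ a₁ → b₀ ≤ b₁ →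
        μ (SemilatticeTensor.pure (Conc.principal a₀ a₁) (Conc.principal b₀ b₁)) =
          Conc.principal (L := LatticeTensor A B)
            ⟨box a₀ b₀, confined_of_orderTop _⟩
            ⟨box a₀ b₁ ⊓ box a₁ b₀, confined_of_orderTop _⟩) := by
  refine ⟨tensorConIso hne, fun a₀ a₁ b₀ b₁ ha hb => ?_, fun a₀ a₁ b₀ b₁ ha hb => ?_,
    fun a₀ a₁ b₀ b₁ ha hb => ?_, fun a₀ a₁ b₀ b₁ ha hb => ?_⟩
  · have le₁ : LatticeTensor.tmul a₀ b₁ ≤ LatticeTensor.tmul a₁ b₁ := tensorSet_mono ha le_rfl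
    have le₂ : LatticeTensor.tmul a₁ b₀ ≤ LatticeTensor.tmul a₁ b₁ := tensorSet_mono le_rfl hb
    refine tensorConIso_pure_eq hne ha hb (sup_le le₁ le₂)
      (LatticeTensor.sup_subset_boxSet ?_ ?_) (.inl ⟨le_rfl, le_rfl⟩) fun x y c d hxy hcd => ?_
    · rintro p (h | h)
      · exact .inl h.1
      · exact mem_boxSet_of_mem_tensorBot h _ _
    · rintro p (h | h)
      · exact .inr h.2
      · exact mem_boxSet_of_mem_tensorBot h _ _
    · have h₁ := hcd ((le_sup_left : LatticeTensor.tmul a₀ b₁ ≤ _ ⊔ LatticeTensor.tmul a₁ b₀)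
        (.inl ⟨le_rfl, le_rfl⟩ : (a₀, b₁) ∈ tensorSet a₀ b₁))
      have h₂ := hcd ((le_sup_right : LatticeTensor.tmul a₁ b₀ ≤ LatticeTensor.tmul a₀ b₁ ⊔ _)
        (.inl ⟨le_rfl, le_rfl⟩ : (a₁, b₀) ∈ tensorSet a₁ b₀))
      rcases hxy with ⟨hx, hy⟩ | h
      · rcases h₁ with h₁ | h₁
        · rcases h₂ with h₂ | h₂
          · exact .inl (.inl (hx.trans h₂))
          · exact .inr ⟨⟨hx, h₁⟩, hy, h₂⟩
        · exact .inl (.inr (hy.trans h₁))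
      · exact .inl (mem_boxSet_of_mem_tensorBot h _ _)
  · refine tensorConIso_pure_eq hne ha hb (fun p hp => ⟨boxSet_mono ha le_rfl hp.1, hp.2⟩)
      Set.inter_subset_left ⟨.inl le_rfl, .inr le_rfl⟩ fun x y c d hxy hcd => ?_
    have h₁ : (a₀, b₁) ∈ boxSet c d := hcd ⟨.inl le_rfl, .inr le_rfl⟩
    have h₂ : (⊤, b₀) ∈ boxSet c d := hcd ⟨.inr le_rfl, .inr hb⟩
    rcases h₂ with h₂ | h₂
    · exact .inl (.inl (le_top.trans h₂))
    rcases hxy with ⟨hx | hy, hx' | hy'⟩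
    · exact .inl (.inl (hx'.trans bot_le))
    · exact h₁.elim (fun h₁ => .inr ⟨⟨hx, h₁⟩, hy', h₂⟩) fun h₁ => .inl (.inr (hy'.trans h₁))
    · exact .inl (.inr (hy.trans h₂))
    · exact .inl (.inr (hy.trans h₂))
  · refine tensorConIso_pure_eq hne ha hb (fun p hp => ⟨boxSet_mono le_rfl hb hp.1, hp.2⟩)
      Set.inter_subset_left ⟨.inr le_rfl, .inl le_rfl⟩ fun x y c d hxy hcd => ?_
    have h₁ : (a₁, b₀) ∈ boxSet c d := hcd ⟨.inr le_rfl, .inl le_rfl⟩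
    have h₂ : (a₀, ⊤) ∈ boxSet c d := hcd ⟨.inl le_rfl, .inl ha⟩
    rcases h₂ with h₂ | h₂
    swap
    · exact .inl (.inr (le_top.trans h₂))
    rcases hxy with ⟨hx | hy, hx' | hy'⟩
    · exact .inl (.inl (hx.trans h₂))
    · exact .inl (.inl (hx.trans h₂))
    · exact h₁.elim (fun h₁ => .inl (.inl (hx'.trans h₁))) fun h₁ => .inr ⟨⟨hx', h₂⟩, hy, h₁⟩
    · exact .inl (.inr (hy'.trans bot_le))
  · refine tensorConIso_pure_eq hne ha hb
      (fun p hp => ⟨boxSet_mono le_rfl hb hp, boxSet_mono ha le_rfl hp⟩)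
      subset_rfl ⟨.inr le_rfl, .inl le_rfl⟩ fun x y c d hxy hcd => ?_
    have h₁ : (a₀, ⊤) ∈ boxSet c d := hcd (.inl le_rfl)
    have h₂ : (⊤, b₀) ∈ boxSet c d := hcd (.inr le_rfl)
    rcases h₁ with h₁ | h₁
    swap
    · exact .inl (.inr (le_top.trans h₁))
    rcases h₂ with h₂ | h₂
    · exact .inl (.inl (le_top.trans h₂))
    rcases hxy with ⟨hx | hy, hx' | hy'⟩
    · exact .inl (.inl (hx.trans h₁))
    · exact .inl (.inl (hx.trans h₁))
    · exact .inr ⟨⟨hx', h₁⟩, hy, h₂⟩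
    · exact .inl (.inr (hy'.trans h₂))
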